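/- Let $n,m$ be natural numbers, let $p_{ij}\in\mathbb R^3$ ($0\le i\le n$, $0\le j\le m$), and let $$\mathbf b(u,v)=\sum_{i=0}^n\sum_{j=0}^m B_i^n(u)B_j^m(v)\,p_{ij},\qquad B_i^n(u)=\binom ni u^i(1-u)^{n-i},\qquad (u,v)\in[0,1]^2,$$ be the Bézier surface with these control points. For a net $(q_{ij})_{0\le i\le N,\,0\le j\le M}$, its triangulated surface is the map on $[0,1]^2$ that takes the value $q_{ij}$ at $(\frac iN,\frac jM)$ and is affine on each of the two triangles into which every cell $[\frac iN,\frac{i+1}N]\times[\frac jM,\frac{j+1}M]$ is cut by the diagonal from $(\frac iN,\frac jM)$ to $(\frac{i+1}N,\frac{j+1}M)$. Let $\mathbf l_k$ be the triangulated surface of the $(2^kn+1)\times(2^km+1)$ control net that arises from $(p_{ij})$ by $k$ de Casteljau subdivisions at the parameter $\frac12$ in both parameter directions; it is the control surface after $k$ subdivisions. We also write $\mathbf b$ and $\mathbf l_k$ for the images in $\mathbb R^3$. Let $\sim$ be the equivalence relation on $[0,1]^2$ that glues opposite edges with the same direction, $(u,0)\sim(u,1)$ and $(0,v)\sim(1,v)$,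 so that $[0,1]^2/{\sim}$ is the torus. 1. (Open case.) Suppose that $p_{i0}\ne p_{im}$ for all $i$ and $p_{0j}\ne p_{nj}$ for all $j$, that $\mathbf b$ is injective on $[0,1]^2$, and that $\mathbf b$ is regular: $\mathbf b_u$ and $\mathbf b_v$ are linearly independent at every point of $[0,1]^2$. Then there is a $K$ such that for every $k\ge K$ the map $\mathbf l_k$ is injective on $[0,1]^2$, and the surfaces $\mathbf l_k$ and $\mathbf b$ are homeomorphic to each other, both being homeomorphic to the square $[0,1]^2$. 2. (Closed case.) Suppose that $p_{i0}=p_{im}$ for all $i$ and $p_{0j}=p_{nj}$ for all $j$, that $\mathbf b(x)=\mathbf b(y)$ for $x,y\in[0,1]^2$ only if $x\sim y$, and that $\mathbf b$ is regular: whenever $x\sim y$ and $w,w'\in\mathbb R^2$ are vectors such that $w$ points from $x$, and $w'$ from $y$, into the square (directions along the edges included), $d\mathbf b_x(w)=d\mathbf b_y(w')$ implies $w=w'$. (That is, at every point of the torus the one-sided directional derivative of the induced map is an injective function of the direction. It contains the linear independence of $\mathbf b_u,\mathbf b_v$ on $[0,1]^2$, and given this independence it holds in particular if the unit normals $\mathbf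 b_u\times\mathbf b_v/|\mathbf b_u\times\mathbf b_v|$ agree at glued points.) Then there is a $K$ such that for every $k\ge K$ one has $\mathbf l_k(x)=\mathbf l_k(y)$ if and only if $x\sim y$, and the surfaces $\mathbf l_k$ and $\mathbf b$ are homeomorphic to each other, both being homeomorphic to the torus $[0,1]^2/{\sim}$. -/

import Mathlib

open scoped unitInterval

namespace BezierSurface

/-- Euclidean three-space. -/
abbrev E3 : Type := EuclideanSpace ℝ (Fin 3)

/-- The parameter square `[0,1] × [0,1]`. -/
abbrev Square : Type := I × I

/-- A parameter point, seen as a point of the plane. -/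
def toPlane (x : Square) : ℝ × ℝ := ((x.1 : ℝ), (x.2 : ℝ))

noncomputable section

/-- The Bézier surface of bidegree `(n, m)` with control points `p i j`, `i ≤ n`, `j ≤ m`
(no other values of `p` are used):
`b(u,v) = ∑_{i ≤ n} ∑_{j ≤ m} B_i^n(u) B_j^m(v) p_{ij}`. -/
def bezier (n m : ℕ) (p : ℕ → ℕ → E3) (x : ℝ × ℝ) : E3 :=
  ∑ i ∈ Finset.range (n + 1), ∑ j ∈ Finset.range (m + 1),
    ((bernsteinPolynomial ℝ n i).eval x.1 * (bernsteinPolynomial ℝ m j).eval x.2) • p i j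

/-- The de Casteljau triangle at the parameter `1/2`: level `r`, position `i`. -/
def deCasteljau (c : ℕ → E3) : ℕ → ℕ → E3
  | 0, i => c i
  | r + 1, i => midpoint ℝ (deCasteljau c r i) (deCasteljau c r (i + 1))

/-- One de Casteljau subdivision at the midpoint of a composite control polygon of degree `n`,
whose piece number `a` has the control points `c (a * n), …, c (a * n + n)`. The piece `a` is
replaced by the pieces `2 * a` (left half, control points `deCasteljau _ i 0`) and `2 * a + 1`
(right half, control points `deCasteljau _ (n - i) i`), with `0 ≤ i ≤ n`; neighbouring pieces
share an end point, so that `0 ≤ i < n` suffices and the last point is the first one of the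
piece that would follow. -/
def subdivideCurve (n : ℕ) (c : ℕ → E3) (k : ℕ) : E3 :=
  let i := k % n
  let piece := fun r => c (k / n / 2 * n + r)
  if k / n % 2 = 0 then deCasteljau piece i 0 else deCasteljau piece (n - i) i

/-- One de Casteljau subdivision of a composite control net, in both parameter directions. -/
def subdivide (n m : ℕ) (q : ℕ → ℕ → E3) : ℕ → ℕ → E3 := fun i j =>
  subdivideCurve m (fun j' => subdivideCurve n (fun i' => q i' j') i) j

/-- The control net after `k` subdivisions; its indices run over `0, …, 2 ^ k * n` and
`0, …, 2 ^ k * m`. -/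
def controlNet (n m : ℕ) (p : ℕ → ℕ → E3) : ℕ → ℕ → ℕ → E3
  | 0 => p
  | k + 1 => subdivide n m (controlNet n m p k)

/-- The uniform parametrization of the triangulated surface spanned by a net `q` with indices
`0, …, N` and `0, …, M`. On the cell `[i/N, (i+1)/N] × [j/M, (j+1)/M]` it is affine on each of
the two triangles cut off by the diagonal from `(i/N, j/M)` to `((i+1)/N, (j+1)/M)`, and its
value at the vertex `(i/N, j/M)` is `q i j`. -/
def triangulated (N M : ℕ) (q : ℕ → ℕ → E3) (x : ℝ × ℝ) : E3 :=
  let i := min ⌊N * x.1⌋₊ (N - 1)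
  let j := min ⌊M * x.2⌋₊ (M - 1)
  let s : ℝ := N * x.1 - i
  let t : ℝ := M * x.2 - j
  if t ≤ s then
    q i j + s • (q (i + 1) j - q i j) + t • (q (i + 1) (j + 1) - q (i + 1) j)
  else
    q i j + t • (q i (j + 1) - q i j) + s • (q (i + 1) (j + 1) - q i (j + 1))

/-- The parametrization of the control surface after `k` subdivisions. -/
def controlSurface (n m : ℕ) (p : ℕ → ℕ → E3) (k : ℕ) : ℝ × ℝ → E3 :=
  triangulated (2 ^ k * n) (2 ^ k * m) (controlNet n m p k)

/-- The Bézier surface as a subspace of space. -/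
def bezierSet (n m : ℕ) (p : ℕ → ℕ → E3) : Set E3 :=
  Set.range fun x : Square => bezier n m p (toPlane x)

/-- The control surface after `k` subdivisions as a subspace of space. -/
def controlSet (n m : ℕ) (p : ℕ → ℕ → E3) (k : ℕ) : Set E3 :=
  Set.range fun x : Square => controlSurface n m p k (toPlane x)

end

/-- The surface is open. -/
def IsOpenNet (n m : ℕ) (p : ℕ → ℕ → E3) : Prop :=
  (∀ i ≤ n, p i 0 ≠ p i m) ∧ (∀ j ≤ m, p 0 j ≠ p n j)

/-- The surface is closed. -/
def IsClosedNet (n m : ℕ) (p : ℕ → ℕ → E3) : Prop :=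
  (∀ i ≤ n, p i 0 = p i m) ∧ (∀ j ≤ m, p 0 j = p n j)

/-- The identification of the two end points of `[0,1]`. -/
def endsSetoid : Setoid I where
  r s t := s = t ∨ (s = 0 ∧ t = 1) ∨ (s = 1 ∧ t = 0)
  iseqv := by
    refine ⟨fun _ => Or.inl rfl, ?_, ?_⟩
    · rintro s t (h | h | h)
      · exact Or.inl h.symm
      · exact Or.inr (Or.inr ⟨h.2, h.1⟩)
      · exact Or.inr (Or.inl ⟨h.2, h.1⟩)
    · rintro s t r (rfl | ⟨rfl, rfl⟩ | ⟨rfl, rfl⟩) (rfl | ⟨h1, rfl⟩ | ⟨h1, rfl⟩) <;> simp_all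

/-- The gluing of opposite edges of the square, with the same direction. -/
def torusSetoid : Setoid Square := endsSetoid.prod endsSetoid

/-- The torus as a quotient space of the square. -/
abbrev Torus : Type := Quotient torusSetoid

/-- The vector `w` points from `x` into the square (edges included). -/
def PointsInward (x : Square) (w : ℝ × ℝ) : Prop :=
  (x.1 = 0 → 0 ≤ w.1) ∧ (x.1 = 1 → w.1 ≤ 0) ∧ (x.2 = 0 → 0 ≤ w.2) ∧ (x.2 = 1 → w.2 ≤ 0)

/-- Regularity of an open surface: the tangent vectors `b_u`, `b_v` are linearly independent
at every point of the square, that is, the differential of `b` is injective there. -/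
def IsRegularOpen (n m : ℕ) (p : ℕ → ℕ → E3) : Prop :=
  ∀ x : Square, Function.Injective (fderiv ℝ (bezier n m p) (toPlane x))

/-- Regularity of a closed surface: at every point of the torus, the one-sided directional
derivative of the map that `b` induces on the torus is injective as a function of the direction.
The derivative in the direction `w` is computed at a representative from which `w` points into
the square. At an interior point this says that `b_u`, `b_v` are linearly independent. -/
def IsRegularClosed (n m : ℕ) (p : ℕ → ℕ → E3) : Prop :=
  ∀ x y : Square, torusSetoid x y → ∀ w w' : ℝ × ℝ, PointsInward x w → PointsInward y w' →
    fderiv ℝ (bezier n m p) (toPlane x) w = fderiv ℝ (bezier n m p) (toPlane y) w' → w = w'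

end BezierSurface

namespace BezierSurface

open Polynomial Filter Topology

/-! Write `seg t` for (1-t) + tX. The linear form sending X^i ⊗ X^j to p_{ij} turns (seg u)^n ⊗ (seg
v)^m into b(u,v), and all control points obtained by subdivision are its values on products of
factors `seg` taken at the ends of dyadic intervals of length 2^{-k} (`controlNet_eq_netPairing`).
Neighbouring control points differ in one factor, so their scaled differences are values of the same
form with a factor X-1. By continuity, control points tend to b and scaled differences to b_u and
b_v, uniformly near each parameter point.

Integrating along coordinate segments gives `hasStrictLimitDeriv_controlSurface`: for y, z near x
and k large, l_k(y) - l_k(z) equals db_x(y-z) up to ε|y-z|. This first-order closeness, and not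
convergence alone, excludes self-intersections on a small scale.

If b(x) ≠ b(y), convergence separates the images of neighbourhoods of x and y. If x and y are equal
or glued, points x' and y' near them are compared through a glued pair a, b near x and y with l_k(a)
= l_k(b). The displacements x'-a and y'-b range over a closed cone on which regularity bounds
db_x(w) - db_y(w') below by a multiple of |(w,w')|. Hence l_k(x') = l_k(y') forces both
displacements to vanish (`exists_glued_of_eq_near`). Compactness of the set of pairs (x,y) gives one
K (`exists_forall_of_forall_near`), and continuous maps from a compact space to a Hausdorff space
supply the homeomorphisms. -/

noncomputable section

/-! ### Polar forms and midpoint subdivision. -/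

/-- The affine polynomial `(1 - t) + t X`. -/
def seg (t : ℝ) : ℝ[X] := C (1 - t) + C t * X

lemma seg_zero : seg 0 = 1 := by simp [seg]

lemma seg_one : seg 1 = X := by simp [seg]

lemma seg_sub_seg (s t : ℝ) : seg s - seg t = (s - t) • (X - 1 : ℝ[X]) := by
  simp only [seg, smul_eq_C_mul, map_sub, map_one]
  ring

lemma seg_midpoint (s t : ℝ) : seg ((s + t) / 2) = (1 / 2 : ℝ) • (seg s + seg t) := by
  have h : (C ((s + t) / 2) : ℝ[X]) = C (1 / 2) * (C s + C t) := by
    rw [← C_add, ← C_mul]; congr 1; ring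
  have h1 : (1 : ℝ[X]) = C (1 / 2) * 2 := by
    rw [← C_ofNat, ← C_mul]; norm_num
  simp only [seg, smul_eq_C_mul, map_sub, map_one, h]
  linear_combination h1

/-- This is the binomial theorem; it makes the Bernstein basis the coefficient sequence of a power.
-/
lemma coeff_seg_pow (t : ℝ) (n i : ℕ) :
    (seg t ^ n).coeff i = (bernsteinPolynomial ℝ n i).eval t := by
  have : seg t = (1 - C t) + C t * X := by simp [seg]
  rw [this, add_comm, add_pow, finsetSum_coeff]
  have h : ∀ k ∈ Finset.range (n + 1),
      ((C t * X) ^ k * (1 - C t) ^ (n - k) * (n.choose k : ℝ[X])).coeff i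
        = if k = i then (n.choose k : ℝ) * t ^ k * (1 - t) ^ (n - k) else 0 := by
    intro k _
    have : (C t * X) ^ k * (1 - C t) ^ (n - k) * (n.choose k : ℝ[X])
        = C ((n.choose k : ℝ) * t ^ k * (1 - t) ^ (n - k)) * X ^ k := by
      simp only [map_mul, map_pow, map_sub, map_one, map_natCast]
      ring
    rw [this, coeff_C_mul_X_pow]
    simp only [eq_comm]
  rw [Finset.sum_congr rfl h, Finset.sum_ite_eq']
  split_ifs with hi
  · simp [bernsteinPolynomial]
  · rw [Finset.mem_range, not_lt] at hi
    rw [bernsteinPolynomial.eq_zero_of_lt ℝ (by omega)]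
    simp

/-- The bilinear pairing of two polynomials with a control net,
`(X ^ i, X ^ j) ↦ p i j` for `i ≤ n` and `j ≤ m`. -/
def netPairing (n m : ℕ) (p : ℕ → ℕ → E3) : ℝ[X] →ₗ[ℝ] ℝ[X] →ₗ[ℝ] E3 :=
  LinearMap.mk₂ ℝ
    (fun f g => ∑ i ∈ Finset.range (n + 1), ∑ j ∈ Finset.range (m + 1),
      (f.coeff i * g.coeff j) • p i j)
    (fun f f' g => by simp only [coeff_add, add_mul, add_smul, Finset.sum_add_distrib])
    (fun a f g => by
      simp only [coeff_smul, smul_eq_mul, Finset.smul_sum, smul_smul, mul_assoc])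
    (fun f g g' => by simp only [coeff_add, mul_add, add_smul, Finset.sum_add_distrib])
    (fun a f g => by
      simp only [coeff_smul, smul_eq_mul, Finset.smul_sum, smul_smul, mul_left_comm])

lemma netPairing_apply (n m : ℕ) (p : ℕ → ℕ → E3) (f g : ℝ[X]) :
    netPairing n m p f g = ∑ i ∈ Finset.range (n + 1), ∑ j ∈ Finset.range (m + 1),
      (f.coeff i * g.coeff j) • p i j := rfl

lemma netPairing_swap (n m : ℕ) (p : ℕ → ℕ → E3) (f g : ℝ[X]) :
    netPairing m n (fun j i => p i j) g f = netPairing n m p f g := by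
  simp only [netPairing_apply]
  rw [Finset.sum_comm]
  simp only [mul_comm]

lemma netPairing_X_pow (n m : ℕ) (p : ℕ → ℕ → E3) {i j : ℕ} (hi : i ≤ n) (hj : j ≤ m) :
    netPairing n m p (X ^ i) (X ^ j) = p i j := by
  rw [netPairing_apply, Finset.sum_eq_single_of_mem i (by simp; omega),
    Finset.sum_eq_single_of_mem j (by simp; omega)]
  · simp
  · intro b _ hb; simp [coeff_X_pow, hb]
  · intro b _ hb; simp [coeff_X_pow, hb]

/-- The polynomials 1 = (seg 0)^n and X^n = (seg 1)^n read off the two boundary rows of the net.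
Closedness of the surfaces and of their tangents along glued edges rests on this. -/
lemma netPairing_one_eq_X_pow {n m : ℕ} {p : ℕ → ℕ → E3} (h : ∀ j ≤ m, p 0 j = p n j)
    (g : ℝ[X]) : netPairing n m p 1 g = netPairing n m p (X ^ n) g := by
  rw [netPairing_apply, netPairing_apply,
    Finset.sum_eq_single_of_mem (s := Finset.range (n + 1)) 0 (by simp),
    Finset.sum_eq_single_of_mem (s := Finset.range (n + 1)) n (by simp)]
  · refine Finset.sum_congr rfl fun j hj => ?_
    rw [h j (by simpa [Nat.lt_succ_iff] using hj)]
    simp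
  · intro b _ hb; simp [coeff_X_pow, hb]
  · intro b _ hb; simp [coeff_one, hb]

lemma bezier_eq_netPairing (n m : ℕ) (p : ℕ → ℕ → E3) (x : ℝ × ℝ) :
    bezier n m p x = netPairing n m p (seg x.1 ^ n) (seg x.2 ^ m) := by
  simp only [bezier, netPairing_apply, coeff_seg_pow]

lemma bezier_swap (n m : ℕ) (p : ℕ → ℕ → E3) (u v : ℝ) :
    bezier m n (fun j i => p i j) (v, u) = bezier n m p (u, v) := by
  simp only [bezier_eq_netPairing, netPairing_swap]

/-- Two neighbours at level `r` differ in a single factor, `seg α` against `seg β`. Since `seg` is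
affine in its parameter, averaging them replaces this factor by `seg` at the midpoint. -/
lemma deCasteljau_of_blossom (Λ : ℝ[X] →ₗ[ℝ] E3) (c : ℕ → E3) (n : ℕ) (α β : ℝ)
    (hc : ∀ r ≤ n, c r = Λ (seg α ^ (n - r) * seg β ^ r)) (r i : ℕ) (h : r + i ≤ n) :
    deCasteljau c r i
      = Λ (seg α ^ (n - r - i) * seg ((α + β) / 2) ^ r * seg β ^ i) := by
  induction r generalizing i with
  | zero => simp [deCasteljau, hc i (by omega)]
  | succ r ih =>
    obtain ⟨d, rfl⟩ : ∃ d, n = d + (r + 1) + i := ⟨n - (r + 1) - i, by omega⟩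
    rw [deCasteljau, ih i (by omega), ih (i + 1) (by omega), midpoint_eq_smul_add, ← map_add,
      ← map_smul, show d + (r + 1) + i - r - i = d + 1 by omega,
      show d + (r + 1) + i - r - (i + 1) = d by omega,
      show d + (r + 1) + i - (r + 1) - i = d by omega, pow_succ (seg ((α + β) / 2)) r]
    congr 1
    nth_rewrite 4 [seg_midpoint]
    simp only [invOf_eq_inv, smul_eq_C_mul, one_div]
    ring

/-- A composite control polygon of `A` pieces of degree `n` over consecutive intervals of
length `h` that is given by the polar form `Λ`. -/
def IsPolarPolygon (n A : ℕ) (h : ℝ) (Λ : ℝ[X] →ₗ[ℝ] E3) (c : ℕ → E3) : Prop :=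
  ∀ a < A, ∀ r ≤ n, c (a * n + r) = Λ (seg (a * h) ^ (n - r) * seg ((a + 1) * h) ^ r)

/-- The two halves are the sides of the de Casteljau triangle, where only the factors at the left
end and the midpoint, or at the midpoint and the right end, survive. The remaining work concerns end
points shared by two pieces. -/
lemma IsPolarPolygon.subdivideCurve {n A : ℕ} (hn : 0 < n) {h : ℝ} {Λ : ℝ[X] →ₗ[ℝ] E3}
    {c : ℕ → E3} (hc : IsPolarPolygon n A h Λ c) :
    IsPolarPolygon n (2 * A) (h / 2) Λ (subdivideCurve n c) := by
  have key : ∀ a < A, ∀ r i : ℕ, r + i ≤ n → deCasteljau (fun r => c (a * n + r)) r i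
      = Λ (seg (a * h) ^ (n - r - i) * seg (a * h + h / 2) ^ r * seg ((a + 1) * h) ^ i) := by
    intro a ha r i hri
    rw [deCasteljau_of_blossom Λ _ n (a * h) ((a + 1) * h) (hc a ha) r i hri]
    congr 5
    ring
  have inner : ∀ a < 2 * A, ∀ r < n, BezierSurface.subdivideCurve n c (a * n + r)
      = Λ (seg (a * (h / 2)) ^ (n - r) * seg ((a + 1) * (h / 2)) ^ r) := by
    intro a ha r hr
    have h1 : (a * n + r) / n = a := by
      rw [mul_comm, Nat.mul_add_div hn, Nat.div_eq_of_lt hr, add_zero]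
    have h2 : (a * n + r) % n = r := by
      rw [mul_comm, Nat.mul_add_mod, Nat.mod_eq_of_lt hr]
    simp only [BezierSurface.subdivideCurve, h1, h2]
    have ha2 : a / 2 < A := by omega
    rcases Nat.even_or_odd' a with ⟨b, rfl | rfl⟩
    · rw [if_pos (by omega), show 2 * b / 2 = b by omega, key b (by omega) _ _ (by omega)]
      have e1 : (2 * b : ℝ) * (h / 2) = b * h := by ring
      have e2 : (2 * b + 1 : ℝ) * (h / 2) = b * h + h / 2 := by ring
      push_cast
      simp only [Nat.sub_zero, pow_zero, mul_one, e1, e2]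
    · rw [if_neg (by omega), show (2 * b + 1) / 2 = b by omega,
        key b (by omega) _ _ (by omega), show n - (n - r) - r = 0 by omega]
      have e1 : (2 * b + 1 : ℝ) * (h / 2) = b * h + h / 2 := by ring
      have e2 : (2 * b + 1 + 1 : ℝ) * (h / 2) = (b + 1) * h := by ring
      push_cast
      simp only [pow_zero, one_mul, e1, e2]
  intro a ha r hr
  rcases hr.lt_or_eq with hr | rfl
  · exact inner a ha r hr
  · simp only [Nat.sub_self, pow_zero, one_mul]
    -- The index `a * n + n` is decoded as position 0 of piece `a + 1`. For the last piece no such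
    -- piece exists, and the value read there is the last point of the old polygon.
    rcases Nat.lt_or_ge (a + 1) (2 * A) with h1 | h1
    · have := inner (a + 1) h1 0 hn
      rw [add_zero, add_mul, one_mul] at this
      rw [this]
      push_cast
      simp
    · have hA2 : a + 1 = 2 * A := by omega
      have hA : 0 < A := by omega
      have h2 : a * r + r = (2 * A) * r := by rw [← hA2]; ring
      rw [h2]
      simp only [BezierSurface.subdivideCurve, Nat.mul_mod_left, Nat.mul_div_cancel _ hn]
      rw [if_pos (by omega), deCasteljau]
      have h3 := hc (A - 1) (by omega) r le_rfl
      have h4 : (A - 1) * r + r = 2 * A / 2 * r + 0 := by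
        rw [show 2 * A / 2 = A - 1 + 1 by omega]; ring
      have h5 : (a : ℝ) + 1 = 2 * A := by exact_mod_cast hA2
      rw [← h4, h3, h5, Nat.cast_sub hA]
      simp only [Nat.sub_self, pow_zero, one_mul]
      congr 3
      push_cast; ring

/-- The control points after `k` subdivisions are values of the polar form. -/
lemma controlNet_eq_netPairing {n m : ℕ} (hn : 0 < n) (hm : 0 < m) (p : ℕ → ℕ → E3) (k : ℕ)
    {a b r s : ℕ} (ha : a < 2 ^ k) (hb : b < 2 ^ k) (hr : r ≤ n) (hs : s ≤ m) :
    controlNet n m p k (a * n + r) (b * m + s) = netPairing n m p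
      (seg (a * (1 / 2) ^ k) ^ (n - r) * seg ((a + 1) * (1 / 2) ^ k) ^ r)
      (seg (b * (1 / 2) ^ k) ^ (m - s) * seg ((b + 1) * (1 / 2) ^ k) ^ s) := by
  induction k generalizing a b r s with
  | zero =>
    obtain rfl : a = 0 := by simpa using ha
    obtain rfl : b = 0 := by simpa using hb
    simp [controlNet, seg_zero, seg_one, netPairing_X_pow n m p hr hs]
  | succ k ih =>
    have e1 : ((1 : ℝ) / 2) ^ (k + 1) = (1 / 2) ^ k / 2 := by rw [pow_succ]; ring
    have e2 : 2 ^ (k + 1) = 2 * 2 ^ k := by rw [pow_succ, mul_comm]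
    -- After subdivision in the first direction, with the index there fixed, the net is a polar
    -- polygon in the second index, so the lemma on curves applies again.
    have h1 : IsPolarPolygon m (2 ^ k) ((1 / 2) ^ k) (netPairing n m p
        (seg (a * (1 / 2) ^ (k + 1)) ^ (n - r) * seg ((a + 1) * (1 / 2) ^ (k + 1)) ^ r))
        (fun j => subdivideCurve n (fun i => controlNet n m p k i j) (a * n + r)) := by
      intro b hb s hs
      have h2 : IsPolarPolygon n (2 ^ k) ((1 / 2) ^ k) ((netPairing n m p).flip
          (seg (b * (1 / 2) ^ k) ^ (m - s) * seg ((b + 1) * (1 / 2) ^ k) ^ s))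
          (fun i => controlNet n m p k i (b * m + s)) := by
        intro a ha r hr
        rw [LinearMap.flip_apply]
        exact ih ha hb hr hs
      have h3 := h2.subdivideCurve hn a (by omega) r hr
      rw [LinearMap.flip_apply, ← e1] at h3
      exact h3
    have h4 := h1.subdivideCurve hm b (by omega) s hs
    rw [← e1] at h4
    exact h4

end

/-! ### Continuity of polar values and derivatives of the Bézier surface. -/

section Continuity

variable {Z : Type*} [TopologicalSpace Z]

lemma continuous_coeff_mul {f g : Z → ℝ[X]} (hf : ∀ i, Continuous fun z => (f z).coeff i)
    (hg : ∀ i, Continuous fun z => (g z).coeff i) (i : ℕ) :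
    Continuous fun z => (f z * g z).coeff i := by
  simp only [coeff_mul]
  exact continuous_finsetSum _ fun q _ => (hf q.1).mul (hg q.2)

lemma continuous_coeff_pow {f : Z → ℝ[X]} (hf : ∀ i, Continuous fun z => (f z).coeff i)
    (r i : ℕ) : Continuous fun z => (f z ^ r).coeff i := by
  induction r generalizing i with
  | zero => simpa using continuous_const
  | succ r ih =>
    simp only [pow_succ]
    exact continuous_coeff_mul ih hf i

lemma continuous_coeff_seg {t : Z → ℝ} (ht : Continuous t) (i : ℕ) :
    Continuous fun z => (seg (t z)).coeff i := by
  simp only [seg, coeff_add, coeff_C, coeff_C_mul]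
  split_ifs <;> fun_prop

lemma continuous_netPairing (n m : ℕ) (p : ℕ → ℕ → E3) {f g : Z → ℝ[X]}
    (hf : ∀ i, Continuous fun z => (f z).coeff i)
    (hg : ∀ i, Continuous fun z => (g z).coeff i) :
    Continuous fun z => netPairing n m p (f z) (g z) := by
  simp only [netPairing_apply]
  exact continuous_finsetSum _ fun i _ => continuous_finsetSum _ fun j _ =>
    ((hf i).mul (hg j)).smul continuous_const

end Continuity

/-- The difference of the powers (seg s)^n and (seg u)^n is divisible by seg s - seg u = (s-u)(X-1),
so the difference quotient is itself a polar expression continuous in s. The same factor X-1 appears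
in differences of control points. -/
lemma hasDerivAt_bezier_fst (n m : ℕ) (p : ℕ → ℕ → E3) (u v : ℝ) :
    HasDerivAt (fun s => bezier n m p (s, v))
      ((n : ℝ) • netPairing n m p ((X - 1) * seg u ^ (n - 1)) (seg v ^ m)) u := by
  set φ : ℝ → E3 := fun s => netPairing n m p
    (∑ i ∈ Finset.range n, (X - 1) * (seg s ^ i * seg u ^ (n - 1 - i))) (seg v ^ m) with hφ
  have hc : Continuous φ := by
    refine continuous_netPairing n m p (fun j => ?_) fun j => continuous_const
    simp only [finsetSum_coeff]
    exact continuous_finsetSum _ fun i _ => continuous_coeff_mul (fun _ => continuous_const)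
      (continuous_coeff_mul (continuous_coeff_pow (continuous_coeff_seg continuous_id) i)
        fun _ => continuous_const) j
  have hu : φ u = (n : ℝ) • netPairing n m p ((X - 1) * seg u ^ (n - 1)) (seg v ^ m) := by
    rw [hφ]
    dsimp only
    rw [Finset.sum_congr rfl (g := fun _ => (X - 1) * seg u ^ (n - 1)), Finset.sum_const,
      Finset.card_range, map_nsmul, LinearMap.smul_apply, Nat.cast_smul_eq_nsmul]
    intro i hi
    rw [Finset.mem_range] at hi
    rw [← pow_add, show i + (n - 1 - i) = n - 1 by omega]
  have hs : ∀ s, bezier n m p (s, v) - bezier n m p (u, v) = (s - u) • φ s := by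
    intro s
    simp only [bezier_eq_netPairing, hφ]
    rw [← LinearMap.sub_apply, ← map_sub, ← LinearMap.smul_apply, ← map_smul,
      ← geom_sum₂_mul, seg_sub_seg, ← Finset.mul_sum]
    congr 2
    simp only [smul_eq_C_mul]
    ring
  rw [hasDerivAt_iff_tendsto_slope, ← hu]
  refine (hc.continuousAt.tendsto.mono_left nhdsWithin_le_nhds).congr' ?_
  filter_upwards [self_mem_nhdsWithin] with s hs'
  rw [slope_def_module, hs, smul_smul, inv_mul_cancel₀ (sub_ne_zero.2 hs'), one_smul]

lemma differentiable_bezier (n m : ℕ) (p : ℕ → ℕ → E3) : Differentiable ℝ (bezier n m p) := by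
  unfold bezier
  refine Differentiable.fun_sum fun i _ => Differentiable.fun_sum fun j _ => ?_
  have h1 : Differentiable ℝ fun x : ℝ × ℝ => (bernsteinPolynomial ℝ n i).eval x.1 :=
    (bernsteinPolynomial ℝ n i).differentiable.fun_comp differentiable_fst
  have h2 : Differentiable ℝ fun x : ℝ × ℝ => (bernsteinPolynomial ℝ m j).eval x.2 :=
    (bernsteinPolynomial ℝ m j).differentiable.fun_comp differentiable_snd
  exact (h1.mul h2).smul_const _

lemma fderiv_bezier_fst (n m : ℕ) (p : ℕ → ℕ → E3) (u v : ℝ) :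
    fderiv ℝ (bezier n m p) (u, v) (1, 0)
      = (n : ℝ) • netPairing n m p ((X - 1) * seg u ^ (n - 1)) (seg v ^ m) := by
  have h1 : HasDerivAt (fun s : ℝ => (s, v)) ((1 : ℝ), (0 : ℝ)) u :=
    (hasDerivAt_id u).prodMk (hasDerivAt_const u v)
  have h2 := (differentiable_bezier n m p (u, v)).hasFDerivAt.comp_hasDerivAt u h1
  exact h2.unique (hasDerivAt_bezier_fst n m p u v)

lemma fderiv_bezier_snd (n m : ℕ) (p : ℕ → ℕ → E3) (u v : ℝ) :
    fderiv ℝ (bezier n m p) (u, v) (0, 1)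
      = fderiv ℝ (bezier m n fun j i => p i j) (v, u) (1, 0) := by
  have h1 : HasDerivAt (fun t : ℝ => (u, t)) ((0 : ℝ), (1 : ℝ)) v :=
    (hasDerivAt_const v u).prodMk (hasDerivAt_id v)
  have h2 := (differentiable_bezier n m p (u, v)).hasFDerivAt.comp_hasDerivAt v h1
  rw [fderiv_bezier_fst]
  refine h2.unique ((hasDerivAt_bezier_fst m n (fun j i => p i j) v u).congr_of_eventuallyEq ?_)
  exact .of_forall fun t => (bezier_swap n m p u t).symm

lemma fderiv_bezier_apply (n m : ℕ) (p : ℕ → ℕ → E3) (x w : ℝ × ℝ) :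
    fderiv ℝ (bezier n m p) x w = w.1 • fderiv ℝ (bezier n m p) x (1, 0)
      + w.2 • fderiv ℝ (bezier n m p) x (0, 1) := by
  rw [← map_smul, ← map_smul, ← map_add]
  simp

/-! ### Convergence of control points and of their scaled differences. -/

/-- Polar values at the end points of small dyadic intervals are close to the diagonal value. -/
lemma eventually_polar_near {n m R S : ℕ} (hn : 0 < n) (hm : 0 < m) (hR : R ≤ n) (hS : S ≤ m)
    (Φ : ℕ → ℕ → (ℝ × ℝ) × (ℝ × ℝ) → E3) (hΦ : ∀ r s, Continuous (Φ r s)) {D : E3} {u v : ℝ}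
    (hD : ∀ r ≤ R, ∀ s ≤ S, Φ r s ((u, u), (v, v)) = D) {ε : ℝ} (hε : 0 < ε) :
    ∃ ρ > 0, ∃ K : ℕ, ∀ k ≥ K, ∀ a b r s : ℕ, r ≤ R → s ≤ S →
      |((a * n + r : ℕ) : ℝ) / ((2 ^ k * n : ℕ) : ℝ) - u| < ρ →
      |((b * m + s : ℕ) : ℝ) / ((2 ^ k * m : ℕ) : ℝ) - v| < ρ →
      ‖Φ r s ((a * (1 / 2) ^ k, (a + 1) * (1 / 2) ^ k), (b * (1 / 2) ^ k, (b + 1) * (1 / 2) ^ k))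
        - D‖ ≤ ε := by
  have h1 : ∀ᶠ z in 𝓝 ((u, u), (v, v)), ∀ r ∈ Finset.range (R + 1),
      ∀ s ∈ Finset.range (S + 1), ‖Φ r s z - D‖ < ε := by
    simp only [Filter.eventually_all_finset]
    intro r hr s hs
    refine ContinuousAt.eventually_lt ?_ continuousAt_const ?_
    · exact ((hΦ r s).sub continuous_const).norm.continuousAt
    · rw [hD r (by simpa [Nat.lt_succ_iff] using hr) s (by simpa [Nat.lt_succ_iff] using hs),
        sub_self, norm_zero]
      exact hε
  obtain ⟨ρ, hρ, hball⟩ := Metric.eventually_nhds_iff.1 h1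
  obtain ⟨K, hK⟩ := exists_pow_lt_of_lt_one (half_pos hρ) (by norm_num : (1 / 2 : ℝ) < 1)
  refine ⟨ρ / 2, half_pos hρ, K, fun k hk a b r s hr hs ha hb => ?_⟩
  have hk' : (1 / 2 : ℝ) ^ k < ρ / 2 :=
    (pow_le_pow_of_le_one (by norm_num) (by norm_num) hk).trans_lt hK
  -- The parameter of a control point lies in its dyadic interval, of length below ρ/2, so both ends
  -- of the interval are within ρ of `w`.
  have aux : ∀ {N c q : ℕ} {w : ℝ}, 0 < N → q ≤ N →
      |((c * N + q : ℕ) : ℝ) / ((2 ^ k * N : ℕ) : ℝ) - w| < ρ / 2 →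
      |c * (1 / 2 : ℝ) ^ k - w| < ρ ∧ |(c + 1) * (1 / 2 : ℝ) ^ k - w| < ρ := by
    intro N c q w hN hq h
    have hN' : (0 : ℝ) < N := by exact_mod_cast hN
    have e : ((c * N + q : ℕ) : ℝ) / ((2 ^ k * N : ℕ) : ℝ)
        = c * (1 / 2 : ℝ) ^ k + q / N * (1 / 2 : ℝ) ^ k := by
      push_cast
      rw [one_div, inv_pow]
      field_simp
    have h0 : 0 ≤ (q : ℝ) / N * (1 / 2 : ℝ) ^ k := by positivity
    have h2 : (q : ℝ) / N * (1 / 2 : ℝ) ^ k ≤ 1 * (1 / 2 : ℝ) ^ k := by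
      gcongr
      rw [div_le_one hN']
      exact_mod_cast hq
    rw [e, abs_lt] at h
    constructor <;> rw [abs_lt] <;> constructor <;> linarith [h.1, h.2]
  obtain ⟨a1, a2⟩ := aux hn (hr.trans hR) ha
  obtain ⟨b1, b2⟩ := aux hm (hs.trans hS) hb
  refine (hball ?_ r (by simpa [Nat.lt_succ_iff] using hr) s
    (by simpa [Nat.lt_succ_iff] using hs)).le
  simp only [Prod.dist_eq, Real.dist_eq, max_lt_iff]
  exact ⟨⟨a1, a2⟩, b1, b2⟩

lemma exists_eq_mul_add_of_lt {n A i : ℕ} (h : i < A * n) :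
    ∃ a < A, ∃ r < n, i = a * n + r :=
  have hn : 0 < n := Nat.pos_of_ne_zero (by rintro rfl; simp at h)
  ⟨i / n, Nat.div_lt_of_lt_mul (by rwa [mul_comm]), i % n, Nat.mod_lt _ hn,
    (Nat.div_add_mod' i n).symm⟩

lemma exists_eq_mul_add_of_le {n A i : ℕ} (hA : 0 < A) (h : i ≤ A * n) :
    ∃ a < A, ∃ r ≤ n, i = a * n + r := by
  rcases h.lt_or_eq with h | rfl
  · obtain ⟨a, ha, r, hr, e⟩ := exists_eq_mul_add_of_lt h
    exact ⟨a, ha, r, hr.le, e⟩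
  · refine ⟨A - 1, by omega, n, le_rfl, ?_⟩
    obtain ⟨B, rfl⟩ : ∃ B, A = B + 1 := ⟨A - 1, by omega⟩
    simp [add_mul]

section Net

variable {n m : ℕ} (hn : 0 < n) (hm : 0 < m) (p : ℕ → ℕ → E3)

include hn hm

/-- Both sides are the same polar value, so the order of the two directions in a subdivision is
immaterial. Estimates are therefore needed in the first direction only. -/
lemma controlNet_swap (k : ℕ) {i j : ℕ} (hi : i ≤ 2 ^ k * n) (hj : j ≤ 2 ^ k * m) :
    controlNet m n (fun j i => p i j) k j i = controlNet n m p k i j := by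
  obtain ⟨a, ha, r, hr, rfl⟩ := exists_eq_mul_add_of_le (by positivity) hi
  obtain ⟨b, hb, s, hs, rfl⟩ := exists_eq_mul_add_of_le (by positivity) hj
  rw [controlNet_eq_netPairing hn hm p k ha hb hr hs,
    controlNet_eq_netPairing hm hn _ k hb ha hs hr, netPairing_swap]

lemma controlNet_zero_eq (h : ∀ j ≤ m, p 0 j = p n j) (k : ℕ) {j : ℕ} (hj : j ≤ 2 ^ k * m) :
    controlNet n m p k 0 j = controlNet n m p k (2 ^ k * n) j := by
  obtain ⟨b, hb, s, hs, rfl⟩ := exists_eq_mul_add_of_le (by positivity) hj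
  have h0 := controlNet_eq_netPairing hn hm p k (a := 0) (r := 0) (by positivity) hb
    (Nat.zero_le _) hs
  have h1 := controlNet_eq_netPairing hn hm p k (a := 2 ^ k - 1) (r := n)
    (Nat.sub_lt (by positivity) one_pos) hb le_rfl hs
  have e1 : (2 ^ k - 1) * n + n = 2 ^ k * n := by
    rw [← Nat.succ_mul, Nat.succ_eq_add_one, Nat.sub_add_cancel Nat.one_le_two_pow]
  have e2 : (((2 ^ k - 1 : ℕ) : ℝ) + 1) * (1 / 2) ^ k = 1 := by
    rw [Nat.cast_sub Nat.one_le_two_pow]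
    push_cast
    rw [sub_add_cancel, ← mul_pow]
    norm_num
  rw [e1, e2] at h1
  rw [zero_mul, zero_add] at h0
  rw [h0, h1]
  simpa [seg_zero, seg_one] using netPairing_one_eq_X_pow h _

lemma eventually_controlNet_near (u v : ℝ) {ε : ℝ} (hε : 0 < ε) :
    ∃ ρ > 0, ∃ K : ℕ, ∀ k ≥ K, ∀ i ≤ 2 ^ k * n, ∀ j ≤ 2 ^ k * m,
      |(i : ℝ) / ((2 ^ k * n : ℕ) : ℝ) - u| < ρ →
      |(j : ℝ) / ((2 ^ k * m : ℕ) : ℝ) - v| < ρ →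
      ‖controlNet n m p k i j - bezier n m p (u, v)‖ ≤ ε := by
  obtain ⟨ρ, hρ, K, H⟩ := eventually_polar_near (D := bezier n m p (u, v)) (u := u) (v := v)
    hn hm le_rfl le_rfl
    (fun r s z => netPairing n m p (seg z.1.1 ^ (n - r) * seg z.1.2 ^ r)
      (seg z.2.1 ^ (m - s) * seg z.2.2 ^ s)) (fun r s => continuous_netPairing n m p
        (continuous_coeff_mul (continuous_coeff_pow (continuous_coeff_seg (by fun_prop)) _)
          (continuous_coeff_pow (continuous_coeff_seg (by fun_prop)) _))
        (continuous_coeff_mul (continuous_coeff_pow (continuous_coeff_seg (by fun_prop)) _)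
          (continuous_coeff_pow (continuous_coeff_seg (by fun_prop)) _)))
    (fun r hr s hs => by
      rw [bezier_eq_netPairing, ← pow_add, ← pow_add, Nat.sub_add_cancel hr,
        Nat.sub_add_cancel hs]) hε
  refine ⟨ρ, hρ, K, fun k hk i hi j hj hiu hjv => ?_⟩
  obtain ⟨a, ha, r, hr, rfl⟩ := exists_eq_mul_add_of_le (by positivity) hi
  obtain ⟨b, hb, s, hs, rfl⟩ := exists_eq_mul_add_of_le (by positivity) hj
  rw [controlNet_eq_netPairing hn hm p k ha hb hr hs]
  exact H k hk a b r s hr hs hiu hjv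

/-- One factor changes by 2^{-k}(X-1); multiplication by 2^k n leaves n times a polar value with n-1
free factors, whose diagonal value is b_u. -/
lemma eventually_controlNet_sub_near (u v : ℝ) {ε : ℝ} (hε : 0 < ε) :
    ∃ ρ > 0, ∃ K : ℕ, ∀ k ≥ K, ∀ i < 2 ^ k * n, ∀ j ≤ 2 ^ k * m,
      |(i : ℝ) / ((2 ^ k * n : ℕ) : ℝ) - u| < ρ →
      |(j : ℝ) / ((2 ^ k * m : ℕ) : ℝ) - v| < ρ →
      ‖((2 ^ k * n : ℕ) : ℝ) • (controlNet n m p k (i + 1) j - controlNet n m p k i j)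
        - fderiv ℝ (bezier n m p) (u, v) (1, 0)‖ ≤ ε := by
  obtain ⟨ρ, hρ, K, H⟩ := eventually_polar_near
    (D := fderiv ℝ (bezier n m p) (u, v) (1, 0)) (u := u) (v := v)
    hn hm (Nat.sub_le n 1) le_rfl
    (fun r s z => (n : ℝ) • netPairing n m p ((X - 1) * (seg z.1.1 ^ (n - 1 - r) * seg z.1.2 ^ r))
      (seg z.2.1 ^ (m - s) * seg z.2.2 ^ s)) (fun r s => (continuous_netPairing n m p
        (continuous_coeff_mul (fun _ => continuous_const)
          (continuous_coeff_mul (continuous_coeff_pow (continuous_coeff_seg (by fun_prop)) _)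
            (continuous_coeff_pow (continuous_coeff_seg (by fun_prop)) _)))
        (continuous_coeff_mul (continuous_coeff_pow (continuous_coeff_seg (by fun_prop)) _)
          (continuous_coeff_pow (continuous_coeff_seg (by fun_prop)) _))).const_smul (n : ℝ))
    (fun r hr s hs => by
      rw [fderiv_bezier_fst, ← pow_add, ← pow_add, Nat.sub_add_cancel hr,
        Nat.sub_add_cancel hs]) hε
  refine ⟨ρ, hρ, K, fun k hk i hi j hj hiu hjv => ?_⟩
  -- The strict bound on `r` keeps `i` and `i + 1` in the same piece.
  obtain ⟨a, ha, r, hr, rfl⟩ := exists_eq_mul_add_of_lt hi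
  obtain ⟨b, hb, s, hs, rfl⟩ := exists_eq_mul_add_of_le (by positivity) hj
  have hH := H k hk a b r s (by omega) hs hiu hjv
  refine le_of_eq_of_le ?_ hH
  congr 2
  rw [add_assoc, controlNet_eq_netPairing hn hm p k ha hb hr.le hs,
    controlNet_eq_netPairing hn hm p k ha hb (Nat.succ_le_of_lt hr) hs, ← LinearMap.sub_apply,
    ← map_sub]
  obtain ⟨d, rfl⟩ : ∃ d, n = d + 1 + r := ⟨n - 1 - r, by omega⟩
  have e : seg (a * (1 / 2) ^ k) ^ (d + 1 + r - (r + 1)) * seg ((a + 1) * (1 / 2) ^ k) ^ (r + 1)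
      - seg (a * (1 / 2) ^ k) ^ (d + 1 + r - r) * seg ((a + 1) * (1 / 2) ^ k) ^ r
      = ((1 / 2 : ℝ) ^ k) • ((X - 1) * (seg (a * (1 / 2) ^ k) ^ (d + 1 + r - 1 - r)
        * seg ((a + 1) * (1 / 2) ^ k) ^ r)) := by
    have e1 : ((1 / 2 : ℝ) ^ k) • (X - 1 : ℝ[X])
        = seg ((a + 1) * (1 / 2) ^ k) - seg (a * (1 / 2) ^ k) := by
      rw [seg_sub_seg]
      congr 1
      ring
    rw [show d + 1 + r - (r + 1) = d by omega, show d + 1 + r - r = d + 1 by omega,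
      show d + 1 + r - 1 - r = d by omega, ← smul_mul_assoc, e1]
    ring
  rw [e, map_smul, LinearMap.smul_apply, smul_smul]
  congr 1
  rw [Nat.cast_mul, Nat.cast_pow, Nat.cast_ofNat, mul_right_comm, ← mul_pow]
  norm_num

end Net

/-! ### Triangulated surfaces: cells, continuity and difference quotients. -/

noncomputable section

/-- The triangulated surface over the cell `(i, j)`, in the local coordinates of the cell. -/
def cellMap (q : ℕ → ℕ → E3) (i j : ℕ) (s t : ℝ) : E3 :=
  if t ≤ s then
    q i j + s • (q (i + 1) j - q i j) + t • (q (i + 1) (j + 1) - q (i + 1) j)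
  else
    q i j + t • (q i (j + 1) - q i j) + s • (q (i + 1) (j + 1) - q i (j + 1))

lemma cellMap_swap (q : ℕ → ℕ → E3) (i j : ℕ) (s t : ℝ) :
    cellMap (fun j i => q i j) j i t s = cellMap q i j s t := by
  unfold cellMap
  rcases lt_trichotomy s t with h | rfl | h
  · rw [if_pos h.le, if_neg h.not_ge]
  · simp only [le_refl, if_true]
    module
  · rw [if_neg h.not_ge, if_pos h.le]

lemma triangulated_swap (N M : ℕ) (q : ℕ → ℕ → E3) (u v : ℝ) :
    triangulated M N (fun j i => q i j) (v, u) = triangulated N M q (u, v) :=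
  cellMap_swap q _ _ _ _

lemma cellMap_succ_zero (q : ℕ → ℕ → E3) (i j : ℕ) {t : ℝ} (h0 : 0 ≤ t) (h1 : t ≤ 1) :
    cellMap q (i + 1) j 0 t = cellMap q i j 1 t := by
  unfold cellMap
  rw [if_pos h1]
  rcases h0.lt_or_eq with h | rfl
  · rw [if_neg h.not_ge]
    module
  · rw [if_pos le_rfl]
    module

lemma cellMap_zero_succ (q : ℕ → ℕ → E3) (i j : ℕ) {s : ℝ} (h0 : 0 ≤ s) (h1 : s ≤ 1) :
    cellMap q i (j + 1) s 0 = cellMap q i j s 1 := by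
  rw [← cellMap_swap q i (j + 1), ← cellMap_swap q i j, cellMap_succ_zero _ _ _ h0 h1]

lemma min_floor_cases {N i : ℕ} {y : ℝ} (hi : i < N) (h0 : (i : ℝ) ≤ y) (h1 : y ≤ i + 1) :
    min ⌊y⌋₊ (N - 1) = i ∨ (min ⌊y⌋₊ (N - 1) = i + 1 ∧ y = i + 1) := by
  rcases h1.lt_or_eq with h | h
  · left
    rw [(Nat.floor_eq_iff ((Nat.cast_nonneg i).trans h0)).2 ⟨h0, h⟩]
    omega
  · have : ⌊y⌋₊ = i + 1 := by
      rw [h]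
      exact_mod_cast Nat.floor_natCast (i + 1)
    rw [this]
    rcases Nat.lt_or_ge (i + 1) N with h' | h'
    · exact Or.inr ⟨by omega, h⟩
    · left
      omega

/-- The floor selects the next cell on shared right and upper edges. Adjacent cell maps agree there,
so the local formula holds on the closed cell. -/
lemma triangulated_eq_cellMap {N M : ℕ} (q : ℕ → ℕ → E3) {u v : ℝ} {i j : ℕ} (hi : i < N)
    (hj : j < M) (hu : (i : ℝ) ≤ N * u) (hu' : N * u ≤ i + 1) (hv : (j : ℝ) ≤ M * v)
    (hv' : M * v ≤ j + 1) :
    triangulated N M q (u, v) = cellMap q i j (N * u - i) (M * v - j) := by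
  change cellMap q (min ⌊N * u⌋₊ (N - 1)) (min ⌊M * v⌋₊ (M - 1))
    (N * u - (min ⌊N * u⌋₊ (N - 1) : ℕ)) (M * v - (min ⌊M * v⌋₊ (M - 1) : ℕ)) = _
  rcases min_floor_cases hi hu hu' with e | ⟨e, e'⟩ <;>
    rcases min_floor_cases hj hv hv' with d | ⟨d, d'⟩ <;> rw [e, d]
  · rw [d', add_sub_cancel_left, ← cellMap_zero_succ q i j (by linarith) (by linarith)]
    simp
  · rw [e', add_sub_cancel_left, ← cellMap_succ_zero q i j (by linarith) (by linarith)]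
    simp
  · rw [d', e', add_sub_cancel_left, add_sub_cancel_left,
      ← cellMap_zero_succ q i j (by norm_num) (by norm_num),
      ← cellMap_succ_zero q i (j + 1) (by norm_num) (by norm_num)]
    simp

lemma continuous_cellMap (q : ℕ → ℕ → E3) (i j : ℕ) :
    Continuous fun z : ℝ × ℝ => cellMap q i j z.1 z.2 := by
  unfold cellMap
  refine Continuous.if_le (by fun_prop) (by fun_prop) continuous_snd continuous_fst ?_
  intro z hz
  rw [hz]
  module

lemma exists_cell {N : ℕ} (hN : 0 < N) {u : ℝ} (hu : u ∈ Set.Icc (0 : ℝ) 1) :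
    ∃ i < N, (i : ℝ) ≤ N * u ∧ N * u ≤ i + 1 := by
  have hN' : (0 : ℝ) < N := by exact_mod_cast hN
  have h0 : 0 ≤ N * u := mul_nonneg hN'.le hu.1
  rcases hu.2.lt_or_eq with h | rfl
  · exact ⟨⌊N * u⌋₊, (Nat.floor_lt h0).2 (by nlinarith), Nat.floor_le h0,
      (Nat.lt_floor_add_one _).le⟩
  · refine ⟨N - 1, by omega, ?_⟩
    rw [Nat.cast_sub hN]
    constructor <;> push_cast <;> linarith

lemma continuousOn_triangulated {N M : ℕ} (hN : 0 < N) (hM : 0 < M) (q : ℕ → ℕ → E3) :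
    ContinuousOn (triangulated N M q) (Set.Icc 0 1 ×ˢ Set.Icc 0 1) := by
  let cell : Fin N × Fin M → Set (ℝ × ℝ) := fun c =>
    {x | (c.1 : ℝ) ≤ N * x.1 ∧ N * x.1 ≤ c.1 + 1 ∧ (c.2 : ℝ) ≤ M * x.2 ∧ M * x.2 ≤ c.2 + 1}
  have hcont : ContinuousOn (triangulated N M q) (⋃ c, cell c) := by
    refine (locallyFinite_of_finite cell).continuousOn_iUnion (fun c => ?_) fun c => ?_
    · have h : ∀ f g : ℝ × ℝ → ℝ, Continuous f → Continuous g → IsClosed {x | f x ≤ g x} :=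
        fun f g hf hg => isClosed_le hf hg
      exact (h (fun x => c.1) (fun x => N * x.1) (by fun_prop) (by fun_prop)).inter
        ((h (fun x => N * x.1) (fun x => c.1 + 1) (by fun_prop) (by fun_prop)).inter
          ((h (fun x => c.2) (fun x => M * x.2) (by fun_prop) (by fun_prop)).inter
            (h (fun x => M * x.2) (fun x => c.2 + 1) (by fun_prop) (by fun_prop))))
    · have h : Continuous fun x : ℝ × ℝ => cellMap q c.1 c.2 (N * x.1 - c.1) (M * x.2 - c.2) :=
        (continuous_cellMap q c.1 c.2).comp
          (by fun_prop : Continuous fun x : ℝ × ℝ => ((N * x.1 - c.1 : ℝ), (M * x.2 - c.2 : ℝ)))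
      refine h.continuousOn.congr fun x hx => ?_
      exact triangulated_eq_cellMap q c.1.2 c.2.2 hx.1 hx.2.1 hx.2.2.1 hx.2.2.2
  refine hcont.mono fun x hx => ?_
  obtain ⟨i, hi, h1, h2⟩ := exists_cell hN hx.1
  obtain ⟨j, hj, h3, h4⟩ := exists_cell hM hx.2
  exact Set.mem_iUnion.2 ⟨(⟨i, hi⟩, ⟨j, hj⟩), h1, h2, h3, h4⟩

/-- Horizontal lines cross triangles on which the surface is affine, and the slope is that of the
horizontal edge of the triangle entered to the right. Right derivatives exist at the breaks too, and
they suffice for the mean value inequality. -/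
lemma exists_hasDerivWithinAt_triangulated {N M : ℕ} (hN : 0 < N) (hM : 0 < M)
    (q : ℕ → ℕ → E3) {u v : ℝ} (hu : u ∈ Set.Ico (0 : ℝ) 1) (hv : v ∈ Set.Icc (0 : ℝ) 1) :
    ∃ i < N, ∃ j ≤ M, |(i : ℝ) - N * u| ≤ 1 ∧ |(j : ℝ) - M * v| ≤ 1 ∧
      HasDerivWithinAt (fun s => triangulated N M q (s, v))
        ((N : ℝ) • (q (i + 1) j - q i j)) (Set.Ici u) u := by
  have hN' : (0 : ℝ) < N := by exact_mod_cast hN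
  have h0 : 0 ≤ N * u := mul_nonneg hN'.le hu.1
  have hi0 := Nat.floor_le h0
  have hi1 := Nat.lt_floor_add_one (N * u)
  have hiN : ⌊N * u⌋₊ < N := (Nat.floor_lt h0).2 (by nlinarith [hu.2])
  generalize ⌊N * u⌋₊ = i at hi0 hi1 hiN
  obtain ⟨j, hj, hj0, hj1⟩ := exists_cell hM hv
  have hev : ∀ᶠ s in 𝓝[≥] u,
      triangulated N M q (s, v) = cellMap q i j (N * s - i) (M * v - j) := by
    have h1 : ∀ᶠ s : ℝ in 𝓝 u, N * s < i + 1 :=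
      (continuous_const.mul continuous_id).continuousAt.eventually_lt continuousAt_const hi1
    filter_upwards [nhdsWithin_le_nhds h1, self_mem_nhdsWithin] with s hs hs'
    exact triangulated_eq_cellMap q hiN hj
      (hi0.trans (mul_le_mul_of_nonneg_left hs' hN'.le)) hs.le hj0 hj1
  have hder : ∀ a d : E3, HasDerivWithinAt (fun s : ℝ => a + (N * s - i) • d)
      ((N : ℝ) • d) (Set.Ici u) u := by
    intro a d
    have h1 : HasDerivAt (fun s : ℝ => N * s - i) (N : ℝ) u := by
      simpa using ((hasDerivAt_id u).const_mul (N : ℝ)).sub_const (i : ℝ)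
    exact ((h1.smul_const d).const_add a).hasDerivWithinAt
  -- A point on the diagonal belongs to the first case, since moving right enters the lower
  -- triangle. The slope comes from row `j` there and from row `j + 1` in the upper triangle.
  rcases le_or_gt (M * v - j) (N * u - i) with h | h
  · refine ⟨i, hiN, j, hj.le, abs_le.2 ⟨by linarith, by linarith⟩,
      abs_le.2 ⟨by linarith, by linarith⟩, ?_⟩
    have hev2 : (fun s => triangulated N M q (s, v)) =ᶠ[𝓝[≥] u] fun s =>
        (q i j + (M * v - j) • (q (i + 1) (j + 1) - q (i + 1) j))
          + (N * s - i) • (q (i + 1) j - q i j) := by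
      filter_upwards [hev, self_mem_nhdsWithin] with s hs hs'
      have : N * u ≤ N * s := mul_le_mul_of_nonneg_left hs' hN'.le
      rw [hs, cellMap, if_pos (by linarith)]
      abel
    exact (hder _ _).congr_of_eventuallyEq hev2 (hev2.self_of_nhdsWithin Set.self_mem_Ici)
  · refine ⟨i, hiN, j + 1, hj, abs_le.2 ⟨by linarith, by linarith⟩,
      abs_le.2 ⟨by push_cast; linarith, by push_cast; linarith⟩, ?_⟩
    have hev2 : (fun s => triangulated N M q (s, v)) =ᶠ[𝓝[≥] u] fun s =>
        (q i j + (M * v - j) • (q i (j + 1) - q i j))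
          + (N * s - i) • (q (i + 1) (j + 1) - q i (j + 1)) := by
      have h1 : ∀ᶠ s : ℝ in 𝓝 u, N * s - i < M * v - j :=
        ((continuous_const.mul continuous_id).sub continuous_const).continuousAt.eventually_lt
          continuousAt_const h
      filter_upwards [hev, nhdsWithin_le_nhds h1] with s hs hs'
      rw [hs, cellMap, if_neg hs'.not_ge]
    exact (hder _ _).congr_of_eventuallyEq hev2 (hev2.self_of_nhdsWithin Set.self_mem_Ici)

/-- If the scaled horizontal differences of a net are `ε`-close to `D` near a horizontal
segment, then so are the horizontal difference quotients of its triangulated surface. -/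
lemma norm_triangulated_sub_sub_smul_le {N M : ℕ} (hN : 0 < N) (hM : 0 < M) (q : ℕ → ℕ → E3)
    {D : E3} {ε u₁ u₂ v : ℝ} (h₁ : 0 ≤ u₁) (h₂ : u₂ ≤ 1) (h : u₁ ≤ u₂)
    (hv : v ∈ Set.Icc (0 : ℝ) 1)
    (hq : ∀ u ∈ Set.Icc u₁ u₂, ∀ i < N, ∀ j ≤ M, |(i : ℝ) - N * u| ≤ 1 →
      |(j : ℝ) - M * v| ≤ 1 → ‖(N : ℝ) • (q (i + 1) j - q i j) - D‖ ≤ ε) :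
    ‖triangulated N M q (u₂, v) - triangulated N M q (u₁, v) - (u₂ - u₁) • D‖
      ≤ ε * (u₂ - u₁) := by
  have hd : ∀ u, ∃ d : E3, u ∈ Set.Ico u₁ u₂ →
      HasDerivWithinAt (fun s => triangulated N M q (s, v) - s • D) d (Set.Ici u) u
        ∧ ‖d‖ ≤ ε := by
    intro u
    by_cases hu : u ∈ Set.Ico u₁ u₂
    · obtain ⟨i, hi, j, hj, hiu, hjv, hder⟩ := exists_hasDerivWithinAt_triangulated hN hM q
        (u := u) ⟨h₁.trans hu.1, hu.2.trans_le h₂⟩ hv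
      refine ⟨_, fun _ => ⟨hder.sub ((hasDerivAt_id u).smul_const D).hasDerivWithinAt, ?_⟩⟩
      rw [one_smul]
      exact hq u ⟨hu.1, hu.2.le⟩ i hi j hj hiu hjv
    -- A default value where nothing is required, so that a derivative can be chosen for every `u`.
    · exact ⟨0, fun h => absurd h hu⟩
  choose f' hf' using hd
  have hc : ContinuousOn (fun s => triangulated N M q (s, v) - s • D) (Set.Icc u₁ u₂) := by
    refine ContinuousOn.sub ?_ (by fun_prop)
    refine (continuousOn_triangulated hN hM q).comp (f := fun s : ℝ => (s, v)) (by fun_prop) ?_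
    exact fun s hs => ⟨⟨h₁.trans hs.1, hs.2.trans h₂⟩, hv⟩
  have := norm_image_sub_le_of_norm_deriv_right_le_segment hc (fun u hu => (hf' u hu).1)
    (fun u hu => (hf' u hu).2) u₂ ⟨h, le_rfl⟩
  refine le_of_eq_of_le ?_ this
  congr 1
  module

/-- The factor 5 = 1 + 2 + 2 counts one vertex and two edges, each of length at most 2ε; it is not
sharp. -/
lemma norm_triangulated_sub_le {N M : ℕ} (hN : 0 < N) (hM : 0 < M) (q : ℕ → ℕ → E3)
    {D : E3} {ε u v : ℝ} (hu : u ∈ Set.Icc (0 : ℝ) 1) (hv : v ∈ Set.Icc (0 : ℝ) 1)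
    (hq : ∀ i ≤ N, ∀ j ≤ M, |(i : ℝ) - N * u| ≤ 1 → |(j : ℝ) - M * v| ≤ 1 → ‖q i j - D‖ ≤ ε) :
    ‖triangulated N M q (u, v) - D‖ ≤ 5 * ε := by
  obtain ⟨i, hi, h1, h2⟩ := exists_cell hN hu
  obtain ⟨j, hj, h3, h4⟩ := exists_cell hM hv
  rw [triangulated_eq_cellMap q hi hj h1 h2 h3 h4]
  have hi0 : |(i : ℝ) - N * u| ≤ 1 := abs_le.2 ⟨by linarith, by linarith⟩
  have hi1 : |((i + 1 : ℕ) : ℝ) - N * u| ≤ 1 := by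
    push_cast; exact abs_le.2 ⟨by linarith, by linarith⟩
  have hj0 : |(j : ℝ) - M * v| ≤ 1 := abs_le.2 ⟨by linarith, by linarith⟩
  have hj1 : |((j + 1 : ℕ) : ℝ) - M * v| ≤ 1 := by
    push_cast; exact abs_le.2 ⟨by linarith, by linarith⟩
  have a00 := hq i hi.le j hj.le hi0 hj0
  have a10 := hq (i + 1) hi j hj.le hi1 hj0
  have a01 := hq i hi.le (j + 1) hj hi0 hj1
  have a11 := hq (i + 1) hi (j + 1) hj hi1 hj1
  have key : ∀ (A B C : E3) (s t : ℝ), 0 ≤ s → s ≤ 1 → 0 ≤ t → t ≤ 1 → ‖A - D‖ ≤ ε →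
      ‖B - D‖ ≤ ε → ‖C - D‖ ≤ ε → ‖A + s • (B - A) + t • (C - B) - D‖ ≤ 5 * ε := by
    intro A B C s t hs hs1 ht ht1 hA hB hC
    have step : ∀ (x y : E3) (r : ℝ), 0 ≤ r → r ≤ 1 → ‖x - D‖ ≤ ε → ‖y - D‖ ≤ ε →
        ‖r • (x - y)‖ ≤ 2 * ε := by
      intro x y r hr hr1 hx hy
      rw [norm_smul, Real.norm_of_nonneg hr]
      have : ‖x - y‖ ≤ 2 * ε := by
        rw [← sub_sub_sub_cancel_right x y D]
        linarith [norm_sub_le (x - D) (y - D)]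
      nlinarith [norm_nonneg (x - y)]
    have e : A + s • (B - A) + t • (C - B) - D = (A - D) + s • (B - A) + t • (C - B) := by abel
    rw [e]
    linarith [norm_add₃_le (a := A - D) (b := s • (B - A)) (c := t • (C - B)),
      step B A s hs hs1 hB hA, step C B t ht ht1 hC hB]
  unfold cellMap
  split_ifs
  · exact key _ _ _ _ _ (by linarith) (by linarith) (by linarith) (by linarith) a00 a10 a11
  · exact key _ _ _ _ _ (by linarith) (by linarith) (by linarith) (by linarith) a00 a01 a11

lemma triangulated_zero_eq_one {N M : ℕ} (hN : 0 < N) (hM : 0 < M) (q : ℕ → ℕ → E3)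
    (h : ∀ j ≤ M, q 0 j = q N j) {v : ℝ} (hv : v ∈ Set.Icc (0 : ℝ) 1) :
    triangulated N M q (0, v) = triangulated N M q (1, v) := by
  obtain ⟨j, hj, h3, h4⟩ := exists_cell hM hv
  obtain ⟨N, rfl⟩ : ∃ L, N = L + 1 := ⟨N - 1, by omega⟩
  rw [triangulated_eq_cellMap q hN hj (by simp) (by simp) h3 h4,
    triangulated_eq_cellMap q (Nat.lt_succ_self N) hj (by simp) (by simp) h3 h4]
  have h0 := h j hj.le
  have h1 := h (j + 1) hj
  simp only [Nat.cast_zero, mul_zero, sub_zero, mul_one]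
  rw [show ((N + 1 : ℕ) : ℝ) - N = 1 by push_cast; ring,
    -- The right edge becomes the left edge of a fictitious cell `N + 1`, where only entries of the
    -- last row `q (N + 1)` contribute.
    ← cellMap_succ_zero q N j (by linarith) (by linarith)]
  simp only [cellMap, zero_smul, add_zero, ← h0, ← h1]
  split_ifs with ht
  · rw [le_antisymm ht (by linarith), zero_smul, zero_smul]
  · rfl

end

lemma triangulated_congr {N M : ℕ} (hN : 0 < N) (hM : 0 < M) {q q' : ℕ → ℕ → E3}
    (h : ∀ i ≤ N, ∀ j ≤ M, q i j = q' i j) : triangulated N M q = triangulated N M q' := by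
  funext x
  have hi : min ⌊N * x.1⌋₊ (N - 1) + 1 ≤ N := by omega
  have hj : min ⌊M * x.2⌋₊ (M - 1) + 1 ≤ M := by omega
  simp only [triangulated]
  rw [h _ (Nat.le_of_succ_le hi) _ (Nat.le_of_succ_le hj), h _ hi _ (Nat.le_of_succ_le hj),
    h _ hi _ hj, h _ (Nat.le_of_succ_le hi) _ hj]

/-! ### First-order convergence of the control surfaces. -/

section Surface

variable {n m : ℕ} (hn : 0 < n) (hm : 0 < m) (p : ℕ → ℕ → E3)

include hn hm

lemma controlSurface_swap (k : ℕ) (u v : ℝ) :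
    controlSurface m n (fun j i => p i j) k (v, u) = controlSurface n m p k (u, v) := by
  rw [controlSurface, controlSurface, ← triangulated_swap (2 ^ k * n)]
  refine congrFun (triangulated_congr (by positivity) (by positivity) fun j hj i hi => ?_) _
  exact controlNet_swap hn hm p k hi hj

lemma continuous_controlSurface (k : ℕ) :
    Continuous fun x : Square => controlSurface n m p k (toPlane x) :=
  (continuousOn_triangulated (by positivity) (by positivity) _).comp_continuous
    (by unfold toPlane; fun_prop) fun x => ⟨x.1.2, x.2.2⟩

lemma controlSurface_zero_eq_one (h : ∀ j ≤ m, p 0 j = p n j) (k : ℕ) {v : ℝ}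
    (hv : v ∈ Set.Icc (0 : ℝ) 1) :
    controlSurface n m p k (0, v) = controlSurface n m p k (1, v) :=
  triangulated_zero_eq_one (by positivity) (by positivity) _
    (fun _ hj => controlNet_zero_eq hn hm p h k hj) hv

omit hm in
lemma abs_div_sub_lt {k K i : ℕ} {ρ u w : ℝ} (hK : (1 / 2 : ℝ) ^ K < ρ / 2) (hk : K ≤ k)
    (hi : |(i : ℝ) - (2 ^ k * n : ℕ) * u| ≤ 1) (hu : |u - w| < ρ / 2) :
    |(i : ℝ) / ((2 ^ k * n : ℕ) : ℝ) - w| < ρ := by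
  have hN : (0 : ℝ) < ((2 ^ k * n : ℕ) : ℝ) := by positivity
  have h1 : (1 : ℝ) / ((2 ^ k * n : ℕ) : ℝ) ≤ (1 / 2) ^ k := by
    rw [div_le_iff₀ hN]
    push_cast
    rw [← mul_assoc, ← mul_pow]
    norm_num
    exact_mod_cast hn
  have h2 : (1 / 2 : ℝ) ^ k ≤ (1 / 2) ^ K :=
    pow_le_pow_of_le_one (by norm_num) (by norm_num) hk
  have h3 : |(i : ℝ) / ((2 ^ k * n : ℕ) : ℝ) - u| ≤ 1 / ((2 ^ k * n : ℕ) : ℝ) := by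
    rw [le_div_iff₀ hN, ← abs_of_pos hN, ← abs_mul, abs_of_pos hN, sub_mul,
      div_mul_cancel₀ _ hN.ne', mul_comm u]
    exact hi
  have h4 := abs_sub_le ((i : ℝ) / ((2 ^ k * n : ℕ) : ℝ)) u w
  linarith

/-- The mean value inequality carries the convergence of scaled differences over to the surface; the
error is proportional to the displacement. -/
lemma controlSurface_fst_near (u v : ℝ) {ε : ℝ} (hε : 0 < ε) :
    ∃ ρ > 0, ∃ K : ℕ, ∀ k ≥ K, ∀ u₁ ∈ Set.Icc (0 : ℝ) 1, ∀ u₂ ∈ Set.Icc (0 : ℝ) 1,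
      ∀ v' ∈ Set.Icc (0 : ℝ) 1, |u₁ - u| < ρ → |u₂ - u| < ρ → |v' - v| < ρ →
      ‖controlSurface n m p k (u₂, v') - controlSurface n m p k (u₁, v')
        - (u₂ - u₁) • fderiv ℝ (bezier n m p) (u, v) (1, 0)‖ ≤ ε * |u₂ - u₁| := by
  obtain ⟨ρ, hρ, K₁, H⟩ := eventually_controlNet_sub_near hn hm p u v hε
  obtain ⟨K₂, hK₂⟩ := exists_pow_lt_of_lt_one (half_pos hρ) (by norm_num : (1 / 2 : ℝ) < 1)
  refine ⟨ρ / 2, half_pos hρ, max K₁ K₂, fun k hk u₁ hu₁ u₂ hu₂ v' hv' h₁ h₂ h₃ => ?_⟩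
  wlog hle : u₁ ≤ u₂ generalizing u₁ u₂
  · have := this u₂ hu₂ u₁ hu₁ h₂ h₁ (le_of_not_ge hle)
    rw [abs_sub_comm, ← norm_neg] at this
    refine le_of_eq_of_le ?_ this
    congr 1
    module
  rw [abs_of_nonneg (sub_nonneg.2 hle)]
  refine norm_triangulated_sub_sub_smul_le (by positivity) (by positivity) _ hu₁.1 hu₂.2 hle hv'
    fun s hs i hi j hj his hjv => ?_
  have hs' : |s - u| < ρ / 2 := by
    rw [abs_lt] at h₁ h₂ ⊢
    constructor <;> linarith [hs.1, hs.2]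
  exact H k (le_of_max_le_left hk) i hi j hj
    (abs_div_sub_lt hn hK₂ (le_of_max_le_right hk) his hs')
    (abs_div_sub_lt hm hK₂ (le_of_max_le_right hk) hjv h₃)

lemma controlSurface_near (x : Square) {ε : ℝ} (hε : 0 < ε) :
    ∃ ρ > 0, ∃ K : ℕ, ∀ k ≥ K, ∀ y : Square, dist y x < ρ →
      ‖controlSurface n m p k (toPlane y) - bezier n m p (toPlane x)‖ ≤ ε := by
  obtain ⟨ρ, hρ, K₁, H⟩ := eventually_controlNet_near hn hm p x.1 x.2 (ε := ε / 5) (by linarith)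
  obtain ⟨K₂, hK₂⟩ := exists_pow_lt_of_lt_one (half_pos hρ) (by norm_num : (1 / 2 : ℝ) < 1)
  refine ⟨ρ / 2, half_pos hρ, max K₁ K₂, fun k hk y hy => ?_⟩
  rw [Prod.dist_eq, max_lt_iff] at hy
  have := norm_triangulated_sub_le (N := 2 ^ k * n) (M := 2 ^ k * m) (D := bezier n m p (x.1, x.2))
    (ε := ε / 5) (by positivity) (by positivity) (controlNet n m p k) y.1.2 y.2.2
    fun i hi j hj his hjv => H k (le_of_max_le_left hk) i hi j hj
      (abs_div_sub_lt hn hK₂ (le_of_max_le_right hk) his hy.1)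
      (abs_div_sub_lt hm hK₂ (le_of_max_le_right hk) hjv hy.2)
  exact this.trans_eq (by ring)

end Surface

/-- The sequence `F` is uniformly strictly differentiable at `x` in the limit, with
derivative `L`. -/
def HasStrictLimitDeriv (F : ℕ → Square → E3) (L : ℝ × ℝ →L[ℝ] E3) (x : Square) : Prop :=
  ∀ ε > 0, ∃ ρ > 0, ∃ K : ℕ, ∀ k ≥ K, ∀ y z : Square, dist y x < ρ → dist z x < ρ →
    ‖F k y - F k z - L (toPlane y - toPlane z)‖ ≤ ε * ‖toPlane y - toPlane z‖

lemma hasStrictLimitDeriv_controlSurface {n m : ℕ} (hn : 0 < n) (hm : 0 < m) (p : ℕ → ℕ → E3)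
    (x : Square) : HasStrictLimitDeriv (fun k y => controlSurface n m p k (toPlane y))
      (fderiv ℝ (bezier n m p) (toPlane x)) x := by
  intro ε hε
  obtain ⟨ρ₁, hρ₁, K₁, H₁⟩ := controlSurface_fst_near hn hm p x.1 x.2 (half_pos hε)
  obtain ⟨ρ₂, hρ₂, K₂, H₂⟩ :=
    controlSurface_fst_near hm hn (fun j i => p i j) x.2 x.1 (half_pos hε)
  refine ⟨min ρ₁ ρ₂, lt_min hρ₁ hρ₂, max K₁ K₂, fun k hk y z hy hz => ?_⟩
  simp only [Prod.dist_eq, max_lt_iff, lt_min_iff] at hy hz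
  -- The path from `z` to `y` turns at the corner `(z.1, y.2)`, and each leg costs ε/2.
  have h₁ := H₁ k (le_of_max_le_left hk) z.1 z.1.2 y.1 y.1.2 y.2 y.2.2 hz.1.1 hy.1.1 hy.1.2
  have h₂ := H₂ k (le_of_max_le_right hk) z.2 z.2.2 y.2 y.2.2 z.1 z.1.2 hz.2.2 hy.2.2 hz.2.1
  rw [controlSurface_swap hn hm, controlSurface_swap hn hm, ← fderiv_bezier_snd] at h₂
  rw [fderiv_bezier_apply]
  have e1 : |(y.1 : ℝ) - z.1| ≤ ‖toPlane y - toPlane z‖ := norm_fst_le (toPlane y - toPlane z)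
  have e2 : |(y.2 : ℝ) - z.2| ≤ ‖toPlane y - toPlane z‖ := norm_snd_le (toPlane y - toPlane z)
  have e3 := norm_add_le_of_le h₁ h₂
  refine (le_of_eq_of_le ?_ e3).trans ?_
  · congr 1
    simp only [toPlane, Prod.fst_sub, Prod.snd_sub]
    abel
  · nlinarith

/-! ### Cones of displacements and local injectivity. -/

/-- A linear map without zeros on a closed cone is bounded below there. -/
lemma exists_mul_norm_le_of_cone {V W : Type*} [NormedAddCommGroup V] [NormedSpace ℝ V]
    [FiniteDimensional ℝ V] [NormedAddCommGroup W] [NormedSpace ℝ W] (Φ : V →L[ℝ] W)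
    {C : Set V} (hC : IsClosed C) (hcone : ∀ z ∈ C, ∀ a : ℝ, 0 ≤ a → a • z ∈ C)
    (hΦ : ∀ z ∈ C, Φ z = 0 → z = 0) : ∃ c > 0, ∀ z ∈ C, c * ‖z‖ ≤ ‖Φ z‖ := by
  have hK : IsCompact (Metric.sphere (0 : V) 1 ∩ C) := (isCompact_sphere 0 1).inter_right hC
  have hnorm : ∀ z ∈ C, z ≠ 0 → ‖z‖⁻¹ • z ∈ Metric.sphere (0 : V) 1 ∩ C := by
    intro z hz h0
    refine ⟨?_, hcone z hz _ (by positivity)⟩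
    rw [mem_sphere_zero_iff_norm, norm_smul, norm_inv, norm_norm,
      inv_mul_cancel₀ (norm_ne_zero_iff.2 h0)]
  rcases (Metric.sphere (0 : V) 1 ∩ C).eq_empty_or_nonempty with he | hne
  · refine ⟨1, one_pos, fun z hz => ?_⟩
    by_cases h0 : z = 0
    · simp [h0]
    · exact absurd (hnorm z hz h0) (by simp [he])
  · obtain ⟨z₀, hz₀, hmin⟩ := hK.exists_isMinOn hne Φ.continuous.norm.continuousOn
    have hz₀' : z₀ ≠ 0 := by
      rintro rfl
      simpa using hz₀.1
    refine ⟨‖Φ z₀‖, norm_pos_iff.2 fun h => hz₀' (hΦ z₀ hz₀.2 h), fun z hz => ?_⟩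
    by_cases h0 : z = 0
    · simp [h0]
    · have h1 : ‖Φ z₀‖ ≤ ‖Φ (‖z‖⁻¹ • z)‖ := hmin (hnorm z hz h0)
      rw [map_smul, norm_smul, norm_inv, norm_norm, inv_mul_eq_div,
        le_div_iff₀ (norm_pos_iff.2 h0)] at h1
      exact h1

/-- The number `w` points from `s` into the unit interval. -/
def PointsIntoInterval (s : I) (w : ℝ) : Prop := (s = 0 → 0 ≤ w) ∧ (s = 1 → w ≤ 0)

lemma pointsInward_iff (x : Square) (w : ℝ × ℝ) :
    PointsInward x w ↔ PointsIntoInterval x.1 w.1 ∧ PointsIntoInterval x.2 w.2 := by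
  simp only [PointsInward, PointsIntoInterval, and_assoc]

/-- The displacements at `s` and at `t` that are used to compare points near `s` with points
near `t`: for `s = t` the displacement takes place at `t` only. -/
def intervalCone (s t : I) : Set (ℝ × ℝ) :=
  {z | if s = t then z.1 = 0 else PointsIntoInterval s z.1 ∧ PointsIntoInterval t z.2}

lemma isClosed_intervalCone (s t : I) : IsClosed (intervalCone s t) := by
  unfold intervalCone PointsIntoInterval
  split_ifs
  · exact isClosed_eq continuous_fst continuous_const
  · have h : ∀ (P : Prop) (f g : ℝ × ℝ → ℝ), Continuous f → Continuous g →
        IsClosed {z | P → f z ≤ g z} := by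
      intro P f g hf hg
      by_cases hP : P
      · simpa [hP] using isClosed_le hf hg
      · simp [hP]
    exact ((h _ (fun _ => 0) Prod.fst (by fun_prop) (by fun_prop)).inter
      (h _ Prod.fst (fun _ => 0) (by fun_prop) (by fun_prop))).inter
      ((h _ (fun _ => 0) Prod.snd (by fun_prop) (by fun_prop)).inter
      (h _ Prod.snd (fun _ => 0) (by fun_prop) (by fun_prop)))

lemma smul_mem_intervalCone {s t : I} {z : ℝ × ℝ} (hz : z ∈ intervalCone s t) {a : ℝ}
    (ha : 0 ≤ a) : a • z ∈ intervalCone s t := by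
  simp only [intervalCone, PointsIntoInterval, Set.mem_ofPred_eq, Prod.smul_fst, Prod.smul_snd,
    smul_eq_mul] at hz ⊢
  split_ifs at hz ⊢
  · simp [hz]
  · exact ⟨⟨fun h => mul_nonneg ha (hz.1.1 h), fun h => mul_nonpos_of_nonneg_of_nonpos ha (hz.1.2 h)⟩,
      fun h => mul_nonneg ha (hz.2.1 h), fun h => mul_nonpos_of_nonneg_of_nonpos ha (hz.2.2 h)⟩

/-- Displacements of the cone point inward after a common shift, which is needed for `s = t`
only. -/
lemma exists_shift {s t : I} {z : ℝ × ℝ} (hz : z ∈ intervalCone s t) :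
    ∃ a : ℝ, (s ≠ t → a = 0) ∧ PointsIntoInterval s (z.1 + a) ∧
      PointsIntoInterval t (z.2 + a) := by
  simp only [intervalCone, Set.mem_ofPred_eq] at hz
  split_ifs at hz with h
  · subst h
    rw [hz]
    by_cases h0 : s = 0
    · subst h0
      exact ⟨|z.2|, by simp, by simp [PointsIntoInterval], by
        simp [PointsIntoInterval, add_comm z.2]
        linarith [neg_abs_le z.2]⟩
    · by_cases h1 : s = 1
      · subst h1
        exact ⟨-|z.2|, by simp, by simp [PointsIntoInterval], by
          simp [PointsIntoInterval]
          linarith [le_abs_self z.2]⟩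
      · exact ⟨0, by simp, by simp [PointsIntoInterval], by simp [PointsIntoInterval, h0, h1]⟩
  · exact ⟨0, by simp, by simpa using hz⟩

/-- Inward directions at opposite ends of the interval have opposite signs, so a common one
vanishes; for equal points the first displacement is zero by convention. -/
lemma eq_zero_of_mem_intervalCone {s t : I} (hst : endsSetoid s t) {z : ℝ × ℝ}
    (hz : z ∈ intervalCone s t) (h : z.1 = z.2) : z = 0 := by
  simp only [intervalCone, Set.mem_ofPred_eq, PointsIntoInterval] at hz
  have : z.1 = 0 := by
    rcases hst with rfl | ⟨rfl, rfl⟩ | ⟨rfl, rfl⟩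
    · simpa using hz
    · simp at hz
      linarith [hz.1, hz.2]
    · simp at hz
      linarith [hz.1, hz.2]
  exact Prod.ext this (h ▸ this)

/-- Passage from `s'` near `s` to `t'` near `t` through glued points. -/
lemma exists_glued {s t : I} (hst : endsSetoid s t) (s' t' : I) :
    ∃ a b : I, endsSetoid a b ∧ dist a s ≤ dist s' s ∧ dist b t ≤ dist s' s ∧
      ((s' : ℝ) - a, (t' : ℝ) - b) ∈ intervalCone s t ∧ (s = t → a = b) := by
  by_cases h : s = t
  · subst h
    exact ⟨s', s', Or.inl rfl, le_rfl, le_rfl, by simp [intervalCone], fun _ => rfl⟩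
  · refine ⟨s, t, hst, by simp, by simp, ?_, fun h' => absurd h' h⟩
    simp only [intervalCone, if_neg h, Set.mem_ofPred_eq, PointsIntoInterval]
    refine ⟨⟨?_, ?_⟩, ?_, ?_⟩ <;> rintro rfl
    · simpa using s'.2.1
    · simpa using s'.2.2
    · simpa using t'.2.1
    · simpa using t'.2.2

/-- The cone of displacements at two glued points of the square. -/
def squareCone (x y : Square) : Set ((ℝ × ℝ) × (ℝ × ℝ)) :=
  {z | (z.1.1, z.2.1) ∈ intervalCone x.1 y.1 ∧ (z.1.2, z.2.2) ∈ intervalCone x.2 y.2}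

/-- Near two points `x`, `y` that are glued, the maps `F k` for large `k` only identify points
that are glued. -/
lemma exists_glued_of_eq_near {F : ℕ → Square → E3} {L L' : ℝ × ℝ →L[ℝ] E3} {x y : Square}
    (hL : HasStrictLimitDeriv F L x) (hL' : HasStrictLimitDeriv F L' y)
    (hxy : torusSetoid x y)
    (hF : x ≠ y → ∀ k, ∀ a b, torusSetoid a b → F k a = F k b)
    (hreg : ∀ z ∈ squareCone x y, L z.1 = L' z.2 → z = 0) :
    ∃ ρ > 0, ∃ K : ℕ, ∀ k ≥ K, ∀ x' y', dist x' x < ρ → dist y' y < ρ → F k x' = F k y' →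
      torusSetoid x' y' ∧ (x = y → x' = y') := by
  let Φ : (ℝ × ℝ) × (ℝ × ℝ) →L[ℝ] E3 :=
    L.comp (ContinuousLinearMap.fst ℝ _ _) - L'.comp (ContinuousLinearMap.snd ℝ _ _)
  have hΦ : ∀ z, Φ z = L z.1 - L' z.2 := fun z => rfl
  obtain ⟨c, hc, hcz⟩ := exists_mul_norm_le_of_cone Φ (C := squareCone x y)
    (((isClosed_intervalCone _ _).preimage (by fun_prop :
        Continuous fun z : (ℝ × ℝ) × (ℝ × ℝ) => (z.1.1, z.2.1))).inter
      ((isClosed_intervalCone _ _).preimage (by fun_prop :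
        Continuous fun z : (ℝ × ℝ) × (ℝ × ℝ) => (z.1.2, z.2.2))))
    (fun z hz a ha => ⟨smul_mem_intervalCone hz.1 ha, smul_mem_intervalCone hz.2 ha⟩)
    (fun z hz h => hreg z hz (sub_eq_zero.1 ((hΦ z).symm.trans h)))
  -- Two errors of c/3 add up to less than the lower bound c on the cone, which will force the
  -- displacements to vanish.
  obtain ⟨ρ₁, hρ₁, K₁, H₁⟩ := hL (c / 3) (by positivity)
  obtain ⟨ρ₂, hρ₂, K₂, H₂⟩ := hL' (c / 3) (by positivity)
  refine ⟨min ρ₁ ρ₂, lt_min hρ₁ hρ₂, max K₁ K₂, fun k hk x' y' hx hy hEq => ?_⟩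
  -- The glued points `a` and `b` have the same image, so equality of the images of `x'` and `y'`
  -- becomes equality of the increments from `a` and from `b`.
  obtain ⟨a₁, b₁, hab₁, ha₁, hb₁, hz₁, he₁⟩ := exists_glued hxy.1 x'.1 y'.1
  obtain ⟨a₂, b₂, hab₂, ha₂, hb₂, hz₂, he₂⟩ := exists_glued hxy.2 x'.2 y'.2
  have hab : torusSetoid (a₁, a₂) (b₁, b₂) := ⟨hab₁, hab₂⟩
  have he : x = y → (a₁, a₂) = (b₁, b₂) := by
    rintro rfl
    rw [he₁ rfl, he₂ rfl]
  have ha : dist (a₁, a₂) x ≤ dist x' x := max_le_max ha₁ ha₂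
  have hb : dist (b₁, b₂) y ≤ dist x' x := max_le_max hb₁ hb₂
  have hFab : F k (a₁, a₂) = F k (b₁, b₂) := by
    by_cases h : x = y
    · rw [he h]
    · exact hF h k _ _ hab
  have hz : (toPlane x' - toPlane (a₁, a₂), toPlane y' - toPlane (b₁, b₂)) ∈ squareCone x y :=
    ⟨hz₁, hz₂⟩
  have h₁ := H₁ k (le_of_max_le_left hk) x' (a₁, a₂) (hx.trans_le (min_le_left _ _))
    (ha.trans_lt (hx.trans_le (min_le_left _ _)))
  have h₂ := H₂ k (le_of_max_le_right hk) y' (b₁, b₂) (hy.trans_le (min_le_right _ _))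
    (hb.trans_lt (hx.trans_le (min_le_right _ _)))
  have h₃ := hcz _ hz
  rw [hΦ] at h₃
  dsimp only at h₃
  rw [hEq, hFab] at h₁
  have h₄ := norm_sub_le_of_le h₂ h₁
  rw [sub_sub_sub_cancel_left] at h₄
  have h₅ := norm_fst_le (toPlane x' - toPlane (a₁, a₂), toPlane y' - toPlane (b₁, b₂))
  have h₆ := norm_snd_le (toPlane x' - toPlane (a₁, a₂), toPlane y' - toPlane (b₁, b₂))
  have h₇ : (toPlane x' - toPlane (a₁, a₂), toPlane y' - toPlane (b₁, b₂)) = 0 :=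
    norm_le_zero_iff.1 (by nlinarith)
  have hinj : Function.Injective toPlane := fun u v h =>
    Prod.ext (Subtype.ext (Prod.ext_iff.1 h).1) (Subtype.ext (Prod.ext_iff.1 h).2)
  obtain rfl := hinj (sub_eq_zero.1 (Prod.ext_iff.1 h₇).1)
  obtain rfl := hinj (sub_eq_zero.1 (Prod.ext_iff.1 h₇).2)
  exact ⟨hab, he⟩

/-! ### Compactness and quotient spaces. -/

/-- A compactness principle: if every two points have neighbourhoods where the maps `F k` for
large `k` only identify points related by `S`, then this holds globally. -/
lemma exists_forall_of_forall_near {P : ℕ → Square → Square → Prop}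
    (h : ∀ x y, ∃ ρ > 0, ∃ K : ℕ, ∀ k ≥ K, ∀ x' y', dist x' x < ρ → dist y' y < ρ → P k x' y') :
    ∃ K : ℕ, ∀ k ≥ K, ∀ x y, P k x y := by
  choose ρ hρ K hK using h
  obtain ⟨t, ht⟩ := CompactSpace.elim_nhds_subcover
    (fun z : Square × Square => Metric.ball z (ρ z.1 z.2))
    fun z => Metric.ball_mem_nhds z (hρ z.1 z.2)
  refine ⟨t.sup fun z => K z.1 z.2, fun k hk x y => ?_⟩
  have hmem : (x, y) ∈ ⋃ z ∈ t, Metric.ball z (ρ z.1 z.2) := ht ▸ Set.mem_univ _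
  obtain ⟨z, hz, hzt⟩ := Set.mem_iUnion₂.1 hmem
  rw [Metric.mem_ball, Prod.dist_eq, max_lt_iff] at hzt
  exact hK z.1 z.2 k ((Finset.le_sup (f := fun z => K z.1 z.2) hz).trans hk) x y hzt.1 hzt.2

/-- The image of a continuous map on a compact space is homeomorphic to the quotient of the
space by the relation of having the same image. -/
lemma nonempty_range_homeomorph_quotient {X Y : Type*} [TopologicalSpace X] [CompactSpace X]
    [TopologicalSpace Y] [T2Space Y] (S : Setoid X) {f : X → Y} (hf : Continuous f)
    (h : ∀ x y, f x = f y ↔ S x y) : Nonempty (Set.range f ≃ₜ Quotient S) := by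
  let g : Quotient S → Y := Quotient.lift f fun x y hxy => (h x y).2 hxy
  have hg : Continuous g := hf.quotient_lift _
  have hinj : Function.Injective g := by
    rintro ⟨x⟩ ⟨y⟩ hxy
    exact Quotient.sound ((h x y).1 hxy)
  have hr : Set.range g = Set.range f := Set.range_quotient_lift _
  exact ⟨(hr ▸ (hg.isClosedEmbedding hinj).isEmbedding.toHomeomorph).symm⟩

/-! ### Degrees, glued edges and regularity. -/

lemma fderiv_bezier_fst_of_degree_zero (m : ℕ) (p : ℕ → ℕ → E3) (u v : ℝ) :
    fderiv ℝ (bezier 0 m p) (u, v) (1, 0) = 0 := by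
  rw [fderiv_bezier_fst, Nat.cast_zero, zero_smul]

lemma degrees_pos_of_injective {n m : ℕ} {p : ℕ → ℕ → E3} {x : ℝ × ℝ}
    (h : ∀ w, fderiv ℝ (bezier n m p) x w = 0 → w = 0) : 0 < n ∧ 0 < m := by
  constructor <;> refine Nat.pos_of_ne_zero ?_ <;> rintro rfl
  · simpa using h (1, 0) (fderiv_bezier_fst_of_degree_zero m p x.1 x.2)
  · simpa using h (0, 1)
      (by rw [fderiv_bezier_snd n 0 p x.1 x.2, fderiv_bezier_fst_of_degree_zero])

lemma continuous_bezier (n m : ℕ) (p : ℕ → ℕ → E3) :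
    Continuous fun x : Square => bezier n m p (toPlane x) :=
  (differentiable_bezier n m p).continuous.comp (by unfold toPlane; fun_prop)

lemma bezier_zero_eq_one {n m : ℕ} {p : ℕ → ℕ → E3} (h : ∀ j ≤ m, p 0 j = p n j) (v : ℝ) :
    bezier n m p (0, v) = bezier n m p (1, v) := by
  simpa [bezier_eq_netPairing, seg_zero, seg_one] using netPairing_one_eq_X_pow h _

/-- The two boundary curves coincide with their parametrizations, hence so do their tangents.
Derivatives across the edge need not agree. -/
lemma fderiv_bezier_fst_zero_eq_one {n m : ℕ} {p : ℕ → ℕ → E3} (h : ∀ i ≤ n, p i 0 = p i m)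
    (u : ℝ) : fderiv ℝ (bezier n m p) (u, 0) (1, 0) = fderiv ℝ (bezier n m p) (u, 1) (1, 0) := by
  rw [fderiv_bezier_fst, fderiv_bezier_fst, ← netPairing_swap n m p _ (seg 0 ^ m),
    ← netPairing_swap n m p _ (seg 1 ^ m)]
  simp only [seg_zero, seg_one, one_pow]
  rw [netPairing_one_eq_X_pow h]

lemma fderiv_bezier_fst_eq_of_glued {n m : ℕ} {p : ℕ → ℕ → E3} (h : ∀ i ≤ n, p i 0 = p i m)
    (u : ℝ) {s t : I} (hst : endsSetoid s t) :
    fderiv ℝ (bezier n m p) (u, s) (1, 0) = fderiv ℝ (bezier n m p) (u, t) (1, 0) := by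
  rcases hst with rfl | ⟨rfl, rfl⟩ | ⟨rfl, rfl⟩
  · rfl
  · exact fderiv_bezier_fst_zero_eq_one h u
  · exact (fderiv_bezier_fst_zero_eq_one h u).symm

lemma eq_of_glued {f : ℝ × ℝ → E3} (h₁ : ∀ v : I, f (0, v) = f (1, v))
    (h₂ : ∀ u : I, f (u, 0) = f (u, 1)) {x y : Square} (h : torusSetoid x y) :
    f (toPlane x) = f (toPlane y) := by
  obtain ⟨x₁, x₂⟩ := x
  obtain ⟨y₁, y₂⟩ := y
  have e₁ : f (x₁, x₂) = f (y₁, x₂) := by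
    rcases h.1 with h | ⟨h, h'⟩ | ⟨h, h'⟩ <;> dsimp only at h
    · rw [h]
    · dsimp only at h'
      simpa [h, h'] using h₁ x₂
    · dsimp only at h'
      simpa [h, h'] using (h₁ x₂).symm
  have e₂ : f (y₁, x₂) = f (y₁, y₂) := by
    rcases h.2 with h | ⟨h, h'⟩ | ⟨h, h'⟩ <;> dsimp only at h
    · rw [h]
    · dsimp only at h'
      simpa [h, h'] using h₂ y₁
    · dsimp only at h'
      simpa [h, h'] using (h₂ y₁).symm
  exact e₁.trans e₂

lemma bezier_eq_of_glued {n m : ℕ} {p : ℕ → ℕ → E3} (hp : IsClosedNet n m p) {x y : Square}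
    (h : torusSetoid x y) : bezier n m p (toPlane x) = bezier n m p (toPlane y) :=
  eq_of_glued (fun v => bezier_zero_eq_one hp.2 v)
    (fun u => by
      rw [← bezier_swap n m p, ← bezier_swap n m p]
      exact bezier_zero_eq_one hp.1 (u : ℝ)) h

lemma controlSurface_eq_of_glued {n m : ℕ} (hn : 0 < n) (hm : 0 < m) {p : ℕ → ℕ → E3}
    (hp : IsClosedNet n m p) (k : ℕ) {x y : Square} (h : torusSetoid x y) :
    controlSurface n m p k (toPlane x) = controlSurface n m p k (toPlane y) :=
  eq_of_glued (fun v => controlSurface_zero_eq_one hn hm p hp.2 k v.2)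
    (fun u => by
      rw [← controlSurface_swap hn hm, ← controlSurface_swap hn hm]
      exact controlSurface_zero_eq_one hm hn _ hp.1 k u.2) h

/-- In a coordinate where `x` and `y` agree, the cone allows displacements that leave the square,
while regularity speaks of inward vectors only. A common shift in that coordinate makes both vectors
inward without affecting the equation, because the differentials agree on it. -/
lemma IsRegularClosed.eq_zero_of_mem_squareCone {n m : ℕ} {p : ℕ → ℕ → E3}
    (hp : IsClosedNet n m p) (hreg : IsRegularClosed n m p) {x y : Square}
    (hxy : torusSetoid x y) {z : (ℝ × ℝ) × (ℝ × ℝ)} (hz : z ∈ squareCone x y)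
    (h : fderiv ℝ (bezier n m p) (toPlane x) z.1 = fderiv ℝ (bezier n m p) (toPlane y) z.2) :
    z = 0 := by
  obtain ⟨a₁, ha₁, hx₁, hy₁⟩ := exists_shift hz.1
  obtain ⟨a₂, ha₂, hx₂, hy₂⟩ := exists_shift hz.2
  have hshift : fderiv ℝ (bezier n m p) (toPlane x) (a₁, a₂)
      = fderiv ℝ (bezier n m p) (toPlane y) (a₁, a₂) := by
    rw [fderiv_bezier_apply, fderiv_bezier_apply n m p (toPlane y)]
    congr 1
    · by_cases he : x.1 = y.1
      · simp only [toPlane, he]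
        rw [fderiv_bezier_fst_eq_of_glued hp.1 _ hxy.2]
      · simp [ha₁ he]
    · by_cases he : x.2 = y.2
      · simp only [toPlane, he, fderiv_bezier_snd]
        rw [fderiv_bezier_fst_eq_of_glued hp.2 _ hxy.1]
      · simp [ha₂ he]
  have heq := hreg x y hxy (z.1 + (a₁, a₂)) (z.2 + (a₁, a₂))
    ((pointsInward_iff _ _).2 ⟨hx₁, hx₂⟩) ((pointsInward_iff _ _).2 ⟨hy₁, hy₂⟩)
    (by rw [map_add, map_add, h, hshift])
  have hz12 : z.1 = z.2 := add_right_cancel heq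
  have h₁ := eq_zero_of_mem_intervalCone hxy.1 hz.1 (by rw [hz12])
  have h₂ := eq_zero_of_mem_intervalCone hxy.2 hz.2 (by rw [hz12])
  exact Prod.ext (Prod.ext (Prod.ext_iff.1 h₁).1 (Prod.ext_iff.1 h₂).1)
    (Prod.ext (Prod.ext_iff.1 h₁).2 (Prod.ext_iff.1 h₂).2)

lemma IsRegularOpen.eq_zero_of_mem_squareCone {n m : ℕ} {p : ℕ → ℕ → E3}
    (hreg : IsRegularOpen n m p) {x : Square} {z : (ℝ × ℝ) × (ℝ × ℝ)} (hz : z ∈ squareCone x x)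
    (h : fderiv ℝ (bezier n m p) (toPlane x) z.1 = fderiv ℝ (bezier n m p) (toPlane x) z.2) :
    z = 0 := by
  have h₁ : z.1 = 0 := Prod.ext (by simpa [squareCone, intervalCone] using hz.1)
    (by simpa [squareCone, intervalCone] using hz.2)
  exact Prod.ext h₁ ((hreg x h).symm.trans h₁)

/-! ### From local to global injectivity. -/

lemma controlSurface_ne_near {n m : ℕ} (hn : 0 < n) (hm : 0 < m) (p : ℕ → ℕ → E3)
    {x y : Square} (h : bezier n m p (toPlane x) ≠ bezier n m p (toPlane y)) :
    ∃ ρ > 0, ∃ K : ℕ, ∀ k ≥ K, ∀ x' y' : Square, dist x' x < ρ → dist y' y < ρ →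
      controlSurface n m p k (toPlane x') ≠ controlSurface n m p k (toPlane y') := by
  have hd : 0 < ‖bezier n m p (toPlane x) - bezier n m p (toPlane y)‖ :=
    norm_pos_iff.2 (sub_ne_zero.2 h)
  obtain ⟨ρ₁, hρ₁, K₁, H₁⟩ := controlSurface_near hn hm p x (div_pos hd three_pos)
  obtain ⟨ρ₂, hρ₂, K₂, H₂⟩ := controlSurface_near hn hm p y (div_pos hd three_pos)
  refine ⟨min ρ₁ ρ₂, lt_min hρ₁ hρ₂, max K₁ K₂, fun k hk x' y' hx hy heq => ?_⟩
  have h₁ := H₁ k (le_of_max_le_left hk) x' (hx.trans_le (min_le_left _ _))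
  have h₂ := H₂ k (le_of_max_le_right hk) y' (hy.trans_le (min_le_right _ _))
  rw [heq] at h₁
  have h₃ := norm_sub_le_of_le h₂ h₁
  rw [sub_sub_sub_cancel_left] at h₃
  linarith

lemma exists_controlSurface_injective {n m : ℕ} (hn : 0 < n) (hm : 0 < m) {p : ℕ → ℕ → E3}
    (hinj : ∀ x y : Square, bezier n m p (toPlane x) = bezier n m p (toPlane y) → x = y)
    (hreg : IsRegularOpen n m p) : ∃ K : ℕ, ∀ k ≥ K, ∀ x y : Square,
      controlSurface n m p k (toPlane x) = controlSurface n m p k (toPlane y) → x = y := by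
  refine exists_forall_of_forall_near fun x y => ?_
  by_cases h : x = y
  · subst h
    obtain ⟨ρ, hρ, K, H⟩ := exists_glued_of_eq_near
      (hasStrictLimitDeriv_controlSurface hn hm p x) (hasStrictLimitDeriv_controlSurface hn hm p x)
      (torusSetoid.refl x) (fun h => absurd rfl h) fun z hz => hreg.eq_zero_of_mem_squareCone hz
    exact ⟨ρ, hρ, K, fun k hk x' y' hx hy he => (H k hk x' y' hx hy he).2 rfl⟩
  · obtain ⟨ρ, hρ, K, H⟩ := controlSurface_ne_near hn hm p (mt (hinj x y) h)
    exact ⟨ρ, hρ, K, fun k hk x' y' hx hy he => absurd he (H k hk x' y' hx hy)⟩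

lemma exists_controlSurface_eq_imp_glued {n m : ℕ} (hn : 0 < n) (hm : 0 < m) {p : ℕ → ℕ → E3}
    (hp : IsClosedNet n m p)
    (hinj : ∀ x y : Square,
      bezier n m p (toPlane x) = bezier n m p (toPlane y) → torusSetoid x y)
    (hreg : IsRegularClosed n m p) : ∃ K : ℕ, ∀ k ≥ K, ∀ x y : Square,
      controlSurface n m p k (toPlane x) = controlSurface n m p k (toPlane y) →
        torusSetoid x y := by
  refine exists_forall_of_forall_near fun x y => ?_
  by_cases h : torusSetoid x y
  · obtain ⟨ρ, hρ, K, H⟩ := exists_glued_of_eq_near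
      (hasStrictLimitDeriv_controlSurface hn hm p x) (hasStrictLimitDeriv_controlSurface hn hm p y)
      h (fun _ k a b hab => controlSurface_eq_of_glued hn hm hp k hab)
      fun z hz => hreg.eq_zero_of_mem_squareCone hp h hz
    exact ⟨ρ, hρ, K, fun k hk x' y' hx hy he => (H k hk x' y' hx hy he).1⟩
  · obtain ⟨ρ, hρ, K, H⟩ := controlSurface_ne_near hn hm p (mt (hinj x y) h)
    exact ⟨ρ, hρ, K, fun k hk x' y' hx hy he => absurd he (H k hk x' y' hx hy)⟩

end BezierSurface

open BezierSurface in
theorem mainTheorem1 (n m : ℕ) (p : ℕ → ℕ → E3) :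
    (IsOpenNet n m p →
      (∀ x y : Square, bezier n m p (toPlane x) = bezier n m p (toPlane y) → x = y) →
      IsRegularOpen n m p →
      ∃ K : ℕ, ∀ k : ℕ, K ≤ k →
        (∀ x y : Square,
          controlSurface n m p k (toPlane x) = controlSurface n m p k (toPlane y) → x = y) ∧
        Nonempty (controlSet n m p k ≃ₜ bezierSet n m p) ∧
        Nonempty (bezierSet n m p ≃ₜ Square) ∧
        Nonempty (controlSet n m p k ≃ₜ Square)) ∧
    (IsClosedNet n m p →
      (∀ x y : Square,
        bezier n m p (toPlane x) = bezier n m p (toPlane y) → torusSetoid x y) →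
      IsRegularClosed n m p →
      ∃ K : ℕ, ∀ k : ℕ, K ≤ k →
        (∀ x y : Square,
          controlSurface n m p k (toPlane x) = controlSurface n m p k (toPlane y) ↔
            torusSetoid x y) ∧
        Nonempty (controlSet n m p k ≃ₜ bezierSet n m p) ∧
        Nonempty (bezierSet n m p ≃ₜ Torus) ∧
        Nonempty (controlSet n m p k ≃ₜ Torus)) := by
  constructor
  · intro _ hinj hreg
    obtain ⟨hn, hm⟩ := degrees_pos_of_injective (p := p) (x := toPlane (0, 0))
      fun w hw => hreg (0, 0) (hw.trans (map_zero _).symm)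
    obtain ⟨K, hK⟩ := exists_controlSurface_injective hn hm hinj hreg
    refine ⟨K, fun k hk => ⟨hK k hk, ?_⟩⟩
    let e₁ : bezierSet n m p ≃ₜ Square :=
      ((continuous_bezier n m p).isClosedEmbedding (hinj · ·)).isEmbedding.toHomeomorph.symm
    let e₂ : controlSet n m p k ≃ₜ Square :=
      ((continuous_controlSurface hn hm p k).isClosedEmbedding
        (hK k hk · ·)).isEmbedding.toHomeomorph.symm
    exact ⟨⟨e₂.trans e₁.symm⟩, ⟨e₁⟩, ⟨e₂⟩⟩
  · intro hp hinj hreg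
    -- At an interior point every vector points inward, so regularity gives an injective
    -- differential there, and both degrees are positive.
    let c : I := ⟨1 / 2, by norm_num, by norm_num⟩
    have hc : ∀ w, PointsInward (c, c) w := by
      have h0 : c ≠ 0 := fun h => by simpa [c] using congrArg Subtype.val h
      have h1 : c ≠ 1 := fun h => by simpa [c] using congrArg Subtype.val h
      exact fun w => ⟨fun h => absurd h h0, fun h => absurd h h1, fun h => absurd h h0,
        fun h => absurd h h1⟩
    obtain ⟨hn, hm⟩ := degrees_pos_of_injective (p := p) (x := toPlane (c, c))
      fun w hw => hreg (c, c) (c, c) (torusSetoid.refl _) w 0 (hc w) (hc 0)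
        (hw.trans (map_zero _).symm)
    obtain ⟨K, hK⟩ := exists_controlSurface_eq_imp_glued hn hm hp hinj hreg
    refine ⟨K, fun k hk => ?_⟩
    have hiff : ∀ x y : Square,
        controlSurface n m p k (toPlane x) = controlSurface n m p k (toPlane y) ↔
          torusSetoid x y :=
      fun x y => ⟨hK k hk x y, controlSurface_eq_of_glued hn hm hp k⟩
    obtain ⟨e₁⟩ := nonempty_range_homeomorph_quotient torusSetoid (continuous_bezier n m p)
      fun x y => ⟨hinj x y, bezier_eq_of_glued hp⟩
    obtain ⟨e₂⟩ := nonempty_range_homeomorph_quotient torusSetoid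
      (continuous_controlSurface hn hm p k) hiff
    exact ⟨hiff, ⟨e₂.trans e₁.symm⟩, ⟨e₁⟩, ⟨e₂⟩⟩
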